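/- Let $\kappa>0$, $m>0$, $a,Q,P\in\mathbb R$, and put $E_+=1+\kappa^2a^2$, $U=r^2+a^2\cos^2\theta$, $\Delta_+(\theta)=1+\kappa^2a^2\cos^2\theta$, $\Delta_+(r)=(r^2+a^2)(1-\kappa^2r^2)-2mr+Q^2+P^2$. Assume that the Kerr–Newman–dS spacetime with these parameters is extreme: $\Delta_+(r)$ has a double root $r_->0$, a simple root $r_+>r_-$, the root $-(2r_-+r_+)$, and no other root. On the exterior region $\mathbb R_t\times(r_-,r_+)\times S^2$ consider the orthonormal coframe $$e^0=\sqrt{\tfrac{\Delta_+(r)}{U}}\Big(dt-\tfrac{a\sin^2\theta}{E_+}d\varphi\Big),\quad e^1=\sqrt{\tfrac{U}{\Delta_+(r)}}\,dr,\quad e^2=\sqrt{\tfrac{U}{\Delta_+(\theta)}}\,d\theta,\quad e^3=\sqrt{\tfrac{\Delta_+(\theta)}{U}}\sin\theta\Big(a\,dt-\tfrac{r^2+a^2}{E_+}d\varphi\Big),$$ its dual frame $(e_\alpha)$ (with $e_0=\tfrac{r^2+a^2}{\sqrt{U\Delta_+(r)}}(\partial_t+\tfrac{aE_+}{r^2+a^2}\partial_\varphi)$,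 and so on), the metric $g=-e^0\otimes e^0+e^1\otimes e^1+e^2\otimes e^2+e^3\otimes e^3$, and the potential $$A=-\tfrac{Qr}{U}\Big(dt-\tfrac{a\sin^2\theta}{E_+}d\varphi\Big)-\tfrac{P\cos\theta}{U}\Big(a\,dt-\tfrac{r^2+a^2}{E_+}d\varphi\Big).$$ Clifford multiplication satisfies $v\cdot v=-g(v,v)$ and is given by $$e^0\mapsto\begin{pmatrix}0&-I\\-I&0\end{pmatrix},\qquad e^j\mapsto\begin{pmatrix}0&\sigma^j\\-\sigma^j&0\end{pmatrix},\qquad \sigma^1=\begin{pmatrix}-1&0\\0&1\end{pmatrix},\ \sigma^2=\begin{pmatrix}0&1\\1&0\end{pmatrix},\ \sigma^3=\begin{pmatrix}0&i\\-i&0\end{pmatrix}.$$ Let $\omega_{\alpha\beta}=-\omega_{\beta\alpha}$ be the Levi-Civita connection forms, $de^\alpha=-\omega^\alpha_\beta\wedge e^\beta$, $\omega_{\alpha\beta}=\eta_{\alpha\alpha}\omega^\alpha_\beta$ with $\eta=\mathrm{diag}(-1,1,1,1)$, and let $\mathscr D\Psi=\sum_\alpha e^\alpha\cdot\nabla_{e_\alpha}\Psi$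 with $\nabla_X\Psi=X(\Psi)-\frac12\sum_{\beta<\gamma}\omega_{\beta\gamma}(X)\,e^\beta\cdot e^\gamma\cdot\Psi$ be the Dirac operator. Let $\lambda,\omega\in\mathbb R$, $k\in\mathbb Z$, and let $\Psi$ be a nontrivial solution of $$\Big(\mathscr D+i\sum_\alpha A(e_\alpha)\,e^\alpha+i\lambda\Big)\Psi=0$$ on the exterior region of the form $\Psi=S_+^{-1}\Phi$, where $$\Phi=e^{-i(\omega t+(k+\frac12)\varphi)}\begin{pmatrix}X_-(r)Y_-(\theta)\\X_+(r)Y_+(\theta)\\X_+(r)Y_-(\theta)\\X_-(r)Y_+(\theta)\end{pmatrix},$$ $$S_+=\Delta_+(r)^{\frac14}\,\mathrm{diag}\big((r+ia\cos\theta)^{\frac12},(r+ia\cos\theta)^{\frac12},(r-ia\cos\theta)^{\frac12},(r-ia\cos\theta)^{\frac12}\big).$$ Here "solution" means that the components of $\Psi$ in the above frame are differentiable and satisfy the equation for $0<\theta<\pi$, and that for fixed $(t,r,\varphi)$ they stay bounded as $\theta\to0,\pi$ (as they do for a continuous spinor field, since the axis belongs to the region). Assume that for some $p\in[1,\infty)$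 and some $t_0$, $\Psi\in L^p$ on the slice $\{t=t_0,\ r_-<r<r_+\}$, with respect to its Riemannian volume and the Hermitian norm on $\mathbb C^4$. Then there is exactly one $\epsilon_+\in\mathbb C$ such that $X_\pm,Y_\pm$ are differentiable and solve the separated equations $$\sqrt{\Delta_+(r)}\,D_{r+}X_+-i\lambda rX_-=\epsilon_+X_-,\qquad \sqrt{\Delta_+(r)}\,D_{r-}X_-+i\lambda rX_+=\epsilon_+X_+ ,$$ $$a\lambda\cos\theta\,Y_-+\sqrt{\Delta_+(\theta)}\,L_{\theta+}Y_+=\epsilon_+Y_-,\qquad -\sqrt{\Delta_+(\theta)}\,L_{\theta-}Y_--a\lambda\cos\theta\,Y_+=\epsilon_+Y_+$$ for $r\in(r_-,r_+)$, $\theta\in(0,\pi)$, where $$D_{r\pm}=\partial_r\mp\tfrac{i}{\Delta_+(r)}\big(\omega(r^2+a^2)+Qr+(k+\tfrac12)E_+a\big),$$ $$L_{\theta\pm}=\partial_\theta\mp\tfrac1{\Delta_+(\theta)}\Big(\omega a\sin\theta+\tfrac{(k+\frac12)E_+}{\sin\theta}-P\cot\theta\Big)+\tfrac12\Big(\cot\theta-\tfrac{\kappa^2a^2\sin\theta\cos\theta}{\Delta_+(\theta)}\Big).$$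 This $\epsilon_+$ is real. Moreover, with $B(r)=\kappa^2(r_+-r)(r+r_++2r_-)$ and $$\sigma_1=B(r_-),\qquad\sigma_2=B'(r_-),\qquad\sigma_3=\frac{\omega a^2+(k+\frac12)E_+a}{-r_-}+\omega r_-,$$ at least one of the following three conditions holds: (i) $(\epsilon_+^2+\lambda^2r_-^2)\sigma_1-\sigma_3^2\ge0$; (ii) $\sigma_2\sigma_3-2\omega\sigma_1=0$; (iii) $r_-\sigma_2\sigma_3+2\sigma_1\sigma_3=0$. If $\epsilon_+=0$, then (i) or (iii) holds; if $\lambda=0$, then (i) or (ii) holds; and if $\lambda=\epsilon_+=0$, then $Q=-2\omega r_-$. -/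

import Mathlib

open scoped Matrix

/-! ## Frames, connection forms and the Dirac operator in a coordinate chart -/

namespace DiracChart

/-- Points of a four-dimensional coordinate chart, and also coordinate components of vectors and
covectors. -/
abbrev Pt := Fin 4 → ℝ

/-- The partial derivative `∂_μ f` at `x`. -/
noncomputable def pd {V : Type*} [NormedAddCommGroup V] [NormedSpace ℝ V]
    (μ : Fin 4) (f : Pt → V) (x : Pt) : V :=
  deriv (fun s : ℝ => f (Function.update x μ s)) (x μ)

/-- `(dθ)(v, w)` at `x`, for a 1-form `θ = θ_ν dx^ν`. -/
noncomputable def extDeriv (θ : Pt → Pt) (x v w : Pt) : ℝ :=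
  ∑ μ, ∑ ν, (pd μ (fun y => θ y ν) x - pd ν (fun y => θ y μ) x) * v μ * w ν

/-- Lorentz signature `(-,+,+,+)`. -/
def eta : Fin 4 → ℝ := ![-1, 1, 1, 1]

/-- The matrices of Clifford multiplication by `e^0, e^1, e^2, e^3`
(with the convention `v · v = - g(v,v)`). -/
noncomputable def gam : Fin 4 → Matrix (Fin 4) (Fin 4) ℂ :=
  ![!![0, 0, -1, 0; 0, 0, 0, -1; -1, 0, 0, 0; 0, -1, 0, 0],
    !![0, 0, -1, 0; 0, 0, 0, 1; 1, 0, 0, 0; 0, -1, 0, 0],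
    !![0, 0, 0, 1; 0, 0, 1, 0; 0, -1, 0, 0; -1, 0, 0, 0],
    !![0, 0, 0, Complex.I; 0, 0, -Complex.I, 0; 0, -Complex.I, 0, 0; Complex.I, 0, 0, 0]]

/-- The Lorentzian metric `-e^0 ⊗ e^0 + e^1 ⊗ e^1 + e^2 ⊗ e^2 + e^3 ⊗ e^3` whose orthonormal
coframe is `co`, in coordinates. -/
noncomputable def metricOf (co : Fin 4 → Pt → Pt) (x : Pt) : Matrix (Fin 4) (Fin 4) ℝ :=
  Matrix.of fun μ ν => ∑ α, eta α * co α x μ * co α x ν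

/-- The Levi-Civita connection forms with both indices lowered: `conn co fr α β γ` is
`ω_{αβ}(e_γ)`, where `co = (e^α)` is an orthonormal coframe and `fr = (e_α)` its dual frame. This is
the (unique) solution of Cartan's structure equations
`de^α = - ω^α_β ∧ e^β`, `ω_{αβ} = - ω_{βα}`, `ω_{αβ} = η_{αα} ω^α_β`, see `conn_antisymm` and
`cartan_structure` below. -/
noncomputable def conn (co fr : Fin 4 → Pt → Pt) (α β γ : Fin 4) (x : Pt) : ℝ :=
  (eta α * extDeriv (co α) x (fr β x) (fr γ x)
    + eta β * extDeriv (co β) x (fr γ x) (fr α x)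
    - eta γ * extDeriv (co γ) x (fr α x) (fr β x)) / 2

theorem extDeriv_swap (θ : Pt → Pt) (x v w : Pt) : extDeriv θ x w v = -extDeriv θ x v w := by
  unfold extDeriv
  rw [Finset.sum_comm, ← Finset.sum_neg_distrib]
  refine Finset.sum_congr rfl fun μ _ => ?_
  rw [← Finset.sum_neg_distrib]
  exact Finset.sum_congr rfl fun ν _ => by ring

theorem conn_antisymm (co fr : Fin 4 → Pt → Pt) (α β γ : Fin 4) (x : Pt) :
    conn co fr α β γ x = -conn co fr β α γ x := by
  unfold conn
  rw [extDeriv_swap (co α) x (fr γ x) (fr β x), extDeriv_swap (co β) x (fr α x) (fr γ x),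
    extDeriv_swap (co γ) x (fr β x) (fr α x)]
  ring

/-- `de^α(e_μ, e_ν) = -(ω^α_β ∧ e^β)(e_μ, e_ν) = ω^α_μ(e_ν) - ω^α_ν(e_μ)`. -/
theorem cartan_structure (co fr : Fin 4 → Pt → Pt) (α μ ν : Fin 4) (x : Pt) :
    extDeriv (co α) x (fr μ x) (fr ν x)
      = eta α * conn co fr α μ ν x - eta α * conn co fr α ν μ x := by
  have h : eta α * eta α = 1 := by fin_cases α <;> simp [eta]
  unfold conn
  rw [extDeriv_swap (co α) x (fr μ x) (fr ν x), extDeriv_swap (co μ) x (fr α x) (fr ν x),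
    extDeriv_swap (co ν) x (fr μ x) (fr α x)]
  linear_combination -(extDeriv (co α) x (fr μ x) (fr ν x)) * h

/-- The spinorial Levi-Civita connection
`∇_{e_α} Ψ = e_α(Ψ) - ½ ∑_{β<γ} ω_{βγ}(e_α) e^β · e^γ · Ψ`, the spinor `Ψ` being given by its
components with respect to the spin frame over `(e^α)`. -/
noncomputable def spinNabla (co fr : Fin 4 → Pt → Pt) (α : Fin 4) (Ψ : Pt → Fin 4 → ℂ) (x : Pt) :
    Fin 4 → ℂ :=
  (∑ μ, ((fr α x μ : ℝ) : ℂ) • pd μ Ψ x)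
    - (1 / 2 : ℂ) • ∑ β, ∑ γ ∈ Finset.Ioi β,
        ((conn co fr β γ α x : ℝ) : ℂ) • ((gam β * gam γ) *ᵥ Ψ x)

/-- The Dirac operator `𝒟 Ψ = e^α · ∇_{e_α} Ψ`. -/
noncomputable def dirac (co fr : Fin 4 → Pt → Pt) (Ψ : Pt → Fin 4 → ℂ) (x : Pt) : Fin 4 → ℂ :=
  ∑ α, gam α *ᵥ spinNabla co fr α Ψ x

/-- The value `θ(v)` of a 1-form on a vector. -/
noncomputable def pair (θ v : Pt) : ℝ := ∑ μ, θ μ * v μ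

end DiracChart

open DiracChart

/-! ## The Kerr-Newman-de Sitter spacetime -/

/-- Parameters of a Kerr-Newman-de Sitter spacetime: `3κ²` is the cosmological constant, `m` the
mass, `a` the angular momentum per unit mass, `Q`, `P` the electric and magnetic charges. -/
structure KNdS where
  κ : ℝ
  m : ℝ
  a : ℝ
  Q : ℝ
  P : ℝ
  κ_pos : 0 < κ
  m_pos : 0 < m

namespace KNdS

variable (M : KNdS)

/-- `E_+ = 1 + κ²a²`. -/
noncomputable def E : ℝ := 1 + M.κ ^ 2 * M.a ^ 2

/-- `U = r² + a² cos² θ`. -/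
noncomputable def U (r θ : ℝ) : ℝ := r ^ 2 + M.a ^ 2 * Real.cos θ ^ 2

/-- `Δ_+(r) = (r² + a²)(1 - κ²r²) - 2mr + Q² + P²`. -/
noncomputable def Δr (r : ℝ) : ℝ :=
  (r ^ 2 + M.a ^ 2) * (1 - M.κ ^ 2 * r ^ 2) - 2 * M.m * r + M.Q ^ 2 + M.P ^ 2

/-- `Δ_+(θ) = 1 + κ²a² cos² θ`. -/
noncomputable def Δθ (θ : ℝ) : ℝ := 1 + M.κ ^ 2 * M.a ^ 2 * Real.cos θ ^ 2

open Polynomial in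
/-- `Δ_+(r)` as a polynomial in `r`. -/
noncomputable def ΔPoly : Polynomial ℝ :=
  (X ^ 2 + C (M.a ^ 2)) * (1 - C (M.κ ^ 2) * X ^ 2) - C (2 * M.m) * X + C (M.Q ^ 2) + C (M.P ^ 2)

theorem eval_ΔPoly (r : ℝ) : M.ΔPoly.eval r = M.Δr r := by
  simp [ΔPoly, Δr]

/-- The spacetime is extreme with event horizon `r = rm` and cosmological horizon `r = rp`:
`Δ_+` has a double positive root `rm`, a simple positive root `rp > rm`, the negative root
`-(2 rm + rp)`, and no other root. -/
structure IsExtreme (rm rp : ℝ) : Prop where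
  rm_pos : 0 < rm
  rm_lt_rp : rm < rp
  roots_eq : M.ΔPoly.roots = {rm, rm, rp, -(2 * rm + rp)}

/-- The orthonormal coframe `e^0, e^1, e^2, e^3`, in the Boyer-Lindquist coordinates
`x = (t, r, θ, φ)`; the Kerr-Newman-de Sitter metric is `metricOf M.coframe`. -/
noncomputable def coframe : Fin 4 → Pt → Pt := fun α x =>
  let r := x 1
  let θ := x 2
  (![Real.sqrt (M.Δr r / M.U r θ) • ![1, 0, 0, -(M.a * Real.sin θ ^ 2 / M.E)],
     Real.sqrt (M.U r θ / M.Δr r) • ![0, 1, 0, 0],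
     Real.sqrt (M.U r θ / M.Δθ θ) • ![0, 0, 1, 0],
     (Real.sqrt (M.Δθ θ / M.U r θ) * Real.sin θ) • ![M.a, 0, 0, -((r ^ 2 + M.a ^ 2) / M.E)]]
    : Fin 4 → Pt) α

/-- The dual orthonormal frame `e_0, e_1, e_2, e_3`. -/
noncomputable def frame : Fin 4 → Pt → Pt := fun α x =>
  let r := x 1
  let θ := x 2
  (![((r ^ 2 + M.a ^ 2) / Real.sqrt (M.U r θ * M.Δr r)) •
        ![1, 0, 0, M.a * M.E / (r ^ 2 + M.a ^ 2)],
     Real.sqrt (M.Δr r / M.U r θ) • ![0, 1, 0, 0],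
     Real.sqrt (M.Δθ θ / M.U r θ) • ![0, 0, 1, 0],
     (-1 / Real.sqrt (M.U r θ * M.Δθ θ)) • ![M.a * Real.sin θ, 0, 0, M.E / Real.sin θ]]
    : Fin 4 → Pt) α

/-- The electromagnetic potential
`A = -(Qr/U)(dt - (a sin²θ/E_+) dφ) - (P cos θ/U)(a dt - ((r²+a²)/E_+) dφ)`. -/
noncomputable def potential (x : Pt) : Pt :=
  let r := x 1
  let θ := x 2
  (-(M.Q * r / M.U r θ)) • ![1, 0, 0, -(M.a * Real.sin θ ^ 2 / M.E)]
    - (M.P * Real.cos θ / M.U r θ) • ![M.a, 0, 0, -((r ^ 2 + M.a ^ 2) / M.E)]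

/-- The Boyer-Lindquist coordinate domain of the exterior region `rm < r < rp` (off the axis). -/
def exterior (rm rp : ℝ) : Set Pt := {x | x 1 ∈ Set.Ioo rm rp ∧ x 2 ∈ Set.Ioo 0 Real.pi}

/-- The Dirac equation `(𝒟 + i e^α A(e_α) + iλ) Ψ = 0` at `x`. -/
def DiracEqAt (lam : ℝ) (Ψ : Pt → Fin 4 → ℂ) (x : Pt) : Prop :=
  dirac M.coframe M.frame Ψ x
    + (∑ α, (Complex.I * ((pair (M.potential x) (M.frame α x) : ℝ) : ℂ)) • (gam α *ᵥ Ψ x))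
    + (Complex.I * (lam : ℂ)) • Ψ x = 0

/-- `Ψ` is a spinor field on the exterior region solving the Dirac equation. The coordinate frame is
singular on the axis `sin θ = 0`, which belongs to the region. In an orthonormal frame with the same
`e_0` that is regular at the axis the components of `Ψ` are continuous, and the change of frame is a
spin rotation, which preserves `|Ψ|`; hence the components of `Ψ` in the coordinate frame stay
bounded at the axis, and this is all that is required of `Ψ` there. -/
structure IsDiracSolution (rm rp lam : ℝ) (Ψ : Pt → Fin 4 → ℂ) : Prop where
  differentiableOn : DifferentiableOn ℝ Ψ (exterior rm rp)
  eq : ∀ x ∈ exterior rm rp, M.DiracEqAt lam Ψ x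
  bounded_at_axis : ∀ t φ : ℝ, ∀ r ∈ Set.Ioo rm rp,
    ∃ C : ℝ, ∀ θ ∈ Set.Ioo 0 Real.pi, ‖Ψ ![t, r, θ, φ]‖ ≤ C

/-- The diagonal matrix `S_+`. -/
noncomputable def S (r θ : ℝ) : Matrix (Fin 4) (Fin 4) ℂ :=
  (((M.Δr r) ^ (1 / 4 : ℝ) : ℝ) : ℂ) • Matrix.diagonal
    ![((r : ℂ) + Complex.I * M.a * Real.cos θ) ^ (1 / 2 : ℂ),
      ((r : ℂ) + Complex.I * M.a * Real.cos θ) ^ (1 / 2 : ℂ),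
      ((r : ℂ) - Complex.I * M.a * Real.cos θ) ^ (1 / 2 : ℂ),
      ((r : ℂ) - Complex.I * M.a * Real.cos θ) ^ (1 / 2 : ℂ)]

/-- `Φ = e^{-i(ωt + (k+½)φ)} (X_- Y_-, X_+ Y_+, X_+ Y_-, X_- Y_+)`. -/
noncomputable def Phi (ω : ℝ) (k : ℤ) (Xp Xm Yp Ym : ℝ → ℂ) (x : Pt) : Fin 4 → ℂ :=
  Complex.exp (-Complex.I * ((ω * x 0 + (k + 1 / 2) * x 3 : ℝ) : ℂ)) •
    ![Xm (x 1) * Ym (x 2), Xp (x 1) * Yp (x 2), Xp (x 1) * Ym (x 2), Xm (x 1) * Yp (x 2)]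

/-- `Ψ = S_+^{-1} Φ` on the exterior region. -/
def IsSeparated (rm rp ω : ℝ) (k : ℤ) (Xp Xm Yp Ym : ℝ → ℂ) (Ψ : Pt → Fin 4 → ℂ) : Prop :=
  ∀ x ∈ exterior rm rp, Ψ x = (M.S (x 1) (x 2))⁻¹ *ᵥ Phi ω k Xp Xm Yp Ym x

/-- The Riemannian volume measure of the slice `{t = t₀, rm < r < rp}` in the coordinates
`(r, θ, φ)`: the density is the square root of the determinant of the induced metric. -/
noncomputable def sliceVolume (rm rp t₀ : ℝ) : MeasureTheory.Measure (ℝ × ℝ × ℝ) :=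
  (MeasureTheory.volume.restrict
      (Set.Ioo rm rp ×ˢ (Set.Ioo 0 Real.pi ×ˢ Set.Ioo 0 (2 * Real.pi)))).withDensity
    fun y => ENNReal.ofReal (Real.sqrt
      ((metricOf M.coframe ![t₀, y.1, y.2.1, y.2.2]).submatrix Fin.succ Fin.succ).det)

/-- `Ψ ∈ L^p(M_(rm,rp))` on the slice `{t = t₀}`, where `|Ψ|` is the Hermitian norm on `ℂ⁴`. -/
def SliceLp (rm rp t₀ p : ℝ) (Ψ : Pt → Fin 4 → ℂ) : Prop :=
  MeasureTheory.MemLp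
    (fun y : ℝ × ℝ × ℝ =>
      (WithLp.toLp 2 (Ψ ![t₀, y.1, y.2.1, y.2.2]) : EuclideanSpace ℂ (Fin 4)))
    (ENNReal.ofReal p) (M.sliceVolume rm rp t₀)

/-! ### Separated equations and the separation constant -/

/-- `D_{r+}` for `s = 1` and `D_{r-}` for `s = -1`:
`∂_r ∓ (i/Δ_+(r)) (ω(r²+a²) + Qr + (k+½) E_+ a)`. -/
noncomputable def Dr (s ω : ℝ) (k : ℤ) (X : ℝ → ℂ) (r : ℝ) : ℂ :=
  deriv X r - Complex.I *
    ((s * (ω * (r ^ 2 + M.a ^ 2) + M.Q * r + (k + 1 / 2) * M.E * M.a) / M.Δr r : ℝ) : ℂ) * X r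

/-- `L_{θ+}` for `s = 1` and `L_{θ-}` for `s = -1`:
`∂_θ ∓ (1/Δ_+(θ)) (ωa sin θ + (k+½)E_+/sin θ - P cot θ) + ½ (cot θ - κ²a² sin θ cos θ/Δ_+(θ))`. -/
noncomputable def Lθ (s ω : ℝ) (k : ℤ) (Y : ℝ → ℂ) (θ : ℝ) : ℂ :=
  deriv Y θ +
    ((-(s * (ω * M.a * Real.sin θ + (k + 1 / 2) * M.E / Real.sin θ - M.P * Real.cot θ) / M.Δθ θ)
      + (Real.cot θ - M.κ ^ 2 * M.a ^ 2 * Real.sin θ * Real.cos θ / M.Δθ θ) / 2 : ℝ) : ℂ) * Y θ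

/-- `ε` is a separation constant `ε_+` for `X_±`, `Y_±`: these functions are differentiable, and
they solve the radial and the angular equations with eigenvalue `ε`. -/
structure IsSeparationConstant (rm rp ω lam : ℝ) (k : ℤ) (Xp Xm Yp Ym : ℝ → ℂ) (ε : ℂ) :
    Prop where
  diff_Xp : ∀ r ∈ Set.Ioo rm rp, DifferentiableAt ℝ Xp r
  diff_Xm : ∀ r ∈ Set.Ioo rm rp, DifferentiableAt ℝ Xm r
  diff_Yp : ∀ θ ∈ Set.Ioo 0 Real.pi, DifferentiableAt ℝ Yp θ
  diff_Ym : ∀ θ ∈ Set.Ioo 0 Real.pi, DifferentiableAt ℝ Ym θ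
  radial_plus : ∀ r ∈ Set.Ioo rm rp,
    (Real.sqrt (M.Δr r) : ℂ) * M.Dr 1 ω k Xp r - Complex.I * lam * r * Xm r = ε * Xm r
  radial_minus : ∀ r ∈ Set.Ioo rm rp,
    (Real.sqrt (M.Δr r) : ℂ) * M.Dr (-1) ω k Xm r + Complex.I * lam * r * Xp r = ε * Xp r
  angular_plus : ∀ θ ∈ Set.Ioo 0 Real.pi,
    M.a * lam * Real.cos θ * Ym θ + (Real.sqrt (M.Δθ θ) : ℂ) * M.Lθ 1 ω k Yp θ = ε * Ym θ
  angular_minus : ∀ θ ∈ Set.Ioo 0 Real.pi,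
    -(M.a * lam * Real.cos θ * Yp θ) - (Real.sqrt (M.Δθ θ) : ℂ) * M.Lθ (-1) ω k Ym θ = ε * Yp θ

/-! ### The constants `σ₁, σ₂, σ₃` -/

/-- `B(r) = κ² (r_+ - r)(r + r_+ + 2 r_-)`. -/
noncomputable def B (rm rp r : ℝ) : ℝ := M.κ ^ 2 * (rp - r) * (r + rp + 2 * rm)

noncomputable def σ₁ (rm rp : ℝ) : ℝ := M.B rm rp rm

noncomputable def σ₂ (rm rp : ℝ) : ℝ := deriv (M.B rm rp) rm

noncomputable def σ₃ (rm ω : ℝ) (k : ℤ) : ℝ :=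
  (ω * M.a ^ 2 + (k + 1 / 2) * M.E * M.a) / (-rm) + ω * rm

/-- Condition (i). -/
def CondI (rm rp ω lam ε : ℝ) (k : ℤ) : Prop :=
  (ε ^ 2 + lam ^ 2 * rm ^ 2) * M.σ₁ rm rp - M.σ₃ rm ω k ^ 2 ≥ 0

/-- Condition (ii). -/
def CondII (rm rp ω : ℝ) (k : ℤ) : Prop :=
  M.σ₂ rm rp * M.σ₃ rm ω k - 2 * ω * M.σ₁ rm rp = 0

/-- Condition (iii). -/
def CondIII (rm rp ω : ℝ) (k : ℤ) : Prop :=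
  rm * M.σ₂ rm rp * M.σ₃ rm ω k + 2 * M.σ₁ rm rp * M.σ₃ rm ω k = 0

end KNdS

/-! ### Exterior derivatives of the coframe -/

namespace DiracChart

/-! Separation. After conjugation by `S` the derivatives of `S` cancel against part of the spin
connection, and each of the four components of the Dirac equation becomes "(radial expression) · Y =
X · (angular expression)", up to a nonvanishing factor (`separated_products`). Dividing at one angle
where Y does not vanish produces a constant ε in the radial equations, and a radius where X does not
vanish carries it over to the angular ones (`exists_isSeparationConstant`).

Reality. The angular operator is symmetric: the flux sin θ √Δ_+(θ) Im(Y_+ conj Y_-) has derivative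
Im ε · sin θ (|Y_+|² + |Y_-|²). Boundedness of Ψ at the axis makes the flux O(sin θ) at both poles.
A monotone function with this property vanishes, so Im ε = 0 (`IsSeparationConstant.im_eq_zero`).

Integrability. Near the double root r_- the volume density of the slice is at least a constant times
1/(r - r_-), which is not integrable. If |X_+|² + |X_-|² stayed away from zero there, |Ψ| would be
bounded below on a set of infinite volume, contradicting membership in L^p for every finite p ≥ 1
(`not_sliceLp_of_lower_bound`).

Lower bound. The radial equations have the form f x' = iαx + βy, f y' = -iαy + conj(β)x. In the
derivative of α(|x|² + |y|²) + 2 Im(β conj(x) y) all terms containing 1/f cancel, and the form is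
definite when |β| < |α|. A Grönwall argument then keeps the solution away from zero
(`exists_lower_bound`). This is used twice. Let W be the numerator of the potential in D_{r±}. If
W(r_-) ≠ 0, take f = (r - r_-)²: then β vanishes at r_- and α does not, a contradiction, so W(r_-) =
0. Now one factor r - r_- cancels, f = r - r_-, and |β| < |α| at r_- is exactly the negation of (i).
Hence (i) always holds, which settles all the alternatives; for λ = ε = 0 it forces σ₃ = 0, and σ₃ =
2ωr_- + Q because W(r_-) = 0. -/

theorem pd_eq_zero_of_const {V : Type*} [NormedAddCommGroup V] [NormedSpace ℝ V] {μ : Fin 4}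
    {f : Pt → V} {x : Pt} (h : ∀ s, f (Function.update x μ s) = f x) : pd μ f x = 0 := by
  unfold pd
  simp [h]

/-- The exterior derivative of a 1-form whose components depend on the coordinates `x 1` and `x 2`
only. -/
theorem extDeriv_of_stationary_axisymmetric {θ : Pt → Pt} {x : Pt} {G : Fin 4 → ℝ → ℝ → ℝ}
    {g₁ g₂ : Fin 4 → ℝ} (hG : ∀ y ν, θ y ν = G ν (y 1) (y 2))
    (h₁ : ∀ ν, HasDerivAt (fun s => G ν s (x 2)) (g₁ ν) (x 1))
    (h₂ : ∀ ν, HasDerivAt (fun s => G ν (x 1) s) (g₂ ν) (x 2)) (v w : Pt) :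
    extDeriv θ x v w
      = ∑ ν, (g₁ ν * (v 1 * w ν - w 1 * v ν) + g₂ ν * (v 2 * w ν - w 2 * v ν)) := by
  have p0 : ∀ ν, pd 0 (fun y => θ y ν) x = 0 := fun ν =>
    pd_eq_zero_of_const fun s => by simp [hG]
  have p3 : ∀ ν, pd 3 (fun y => θ y ν) x = 0 := fun ν =>
    pd_eq_zero_of_const fun s => by simp [hG]
  have p1 : ∀ ν, pd 1 (fun y => θ y ν) x = g₁ ν := fun ν => by
    simpa [pd, hG] using (h₁ ν).deriv
  have p2 : ∀ ν, pd 2 (fun y => θ y ν) x = g₂ ν := fun ν => by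
    simpa [pd, hG] using (h₂ ν).deriv
  simp only [extDeriv, Fin.sum_univ_four, p0, p1, p2, p3]
  ring

theorem extDeriv_self (θ : Pt → Pt) (x v : Pt) : extDeriv θ x v v = 0 := by
  have := extDeriv_swap θ x v v
  linarith

end DiracChart

namespace KNdS

variable (M : KNdS)

/-- The derivative of `Δ_+(r)`. -/
noncomputable def Δr' (r : ℝ) : ℝ :=
  2 * r * (1 - M.κ ^ 2 * r ^ 2) - (r ^ 2 + M.a ^ 2) * (2 * M.κ ^ 2 * r) - 2 * M.m

theorem hasDerivAt_Δr (r : ℝ) : HasDerivAt M.Δr (M.Δr' r) r := by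
  have h := ((((((hasDerivAt_id r).pow 2).add_const (M.a ^ 2)).mul
    ((((hasDerivAt_id r).pow 2).const_mul (M.κ ^ 2)).const_sub 1)).sub
    ((hasDerivAt_id r).const_mul (2 * M.m))).add_const (M.Q ^ 2)).add_const (M.P ^ 2)
  refine (h.congr_deriv ?_).congr_of_eventuallyEq (Filter.Eventually.of_forall fun y => ?_)
  · simp [Δr']; ring
  · simp [Δr]

theorem hasDerivAt_U_left (r θ : ℝ) : HasDerivAt (fun s => M.U s θ) (2 * r) r := by
  simpa [U] using ((hasDerivAt_id r).pow 2).add_const (M.a ^ 2 * Real.cos θ ^ 2)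

theorem hasDerivAt_U_right (r θ : ℝ) :
    HasDerivAt (fun s => M.U r s) (-2 * M.a ^ 2 * Real.cos θ * Real.sin θ) θ := by
  have h := (((Real.hasDerivAt_cos θ).pow 2).const_mul (M.a ^ 2)).const_add (r ^ 2)
  refine (h.congr_deriv ?_).congr_of_eventuallyEq (Filter.Eventually.of_forall fun y => ?_)
  · simp; ring
  · simp [U]

theorem hasDerivAt_Δθ (θ : ℝ) :
    HasDerivAt M.Δθ (-2 * M.κ ^ 2 * M.a ^ 2 * Real.cos θ * Real.sin θ) θ := by
  have h := (((Real.hasDerivAt_cos θ).pow 2).const_mul (M.κ ^ 2 * M.a ^ 2)).const_add 1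
  refine (h.congr_deriv ?_).congr_of_eventuallyEq (Filter.Eventually.of_forall fun y => ?_)
  · simp; ring
  · simp [Δθ]

theorem E_pos : 0 < M.E := by unfold E; positivity

theorem Δθ_pos (θ : ℝ) : 0 < M.Δθ θ := by unfold Δθ; positivity

theorem U_pos {r : ℝ} (hr : 0 < r) (θ : ℝ) : 0 < M.U r θ := by unfold U; positivity

end KNdS

theorem HasDerivAt.sqrt_div {f g : ℝ → ℝ} {f' g' x : ℝ} (hf : HasDerivAt f f' x)
    (hg : HasDerivAt g g' x) (hfx : 0 < f x) (hgx : 0 < g x) :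
    HasDerivAt (fun y => Real.sqrt (f y / g y))
      ((f' * g x - f x * g') / (2 * Real.sqrt (f x) * Real.sqrt (g x) ^ 3)) x := by
  refine ((hf.div hg hgx.ne').sqrt (div_pos hfx hgx).ne').congr_deriv ?_
  simp only [Pi.div_apply]
  rw [Real.sqrt_div hfx.le]
  have h1 := Real.sqrt_pos.2 hfx
  have h2 := Real.sqrt_pos.2 hgx
  have h3 := Real.sq_sqrt hgx.le
  generalize Real.sqrt (f x) = p at *
  generalize Real.sqrt (g x) = q at *
  rw [← h3]
  field_simp

namespace KNdS

variable (M : KNdS)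

variable {M} in
theorem extDeriv_coframe_zero {x : Pt} (hr : 0 < x 1) (hΔ : 0 < M.Δr (x 1)) (v w : Pt) :
    extDeriv (M.coframe 0) x v w
      = (M.Δr' (x 1) * √(M.U (x 1) (x 2)) ^ 2 - 2 * x 1 * √(M.Δr (x 1)) ^ 2)
          / (2 * √(M.Δr (x 1)) * √(M.U (x 1) (x 2)) ^ 3)
          * ((v 1 * w 0 - w 1 * v 0)
            - M.a * Real.sin (x 2) ^ 2 / M.E * (v 1 * w 3 - w 1 * v 3))
        + M.a ^ 2 * Real.cos (x 2) * Real.sin (x 2) * √(M.Δr (x 1)) / √(M.U (x 1) (x 2)) ^ 3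
          * ((v 2 * w 0 - w 2 * v 0)
            - M.a * Real.sin (x 2) ^ 2 / M.E * (v 2 * w 3 - w 2 * v 3))
        - √(M.Δr (x 1)) / √(M.U (x 1) (x 2)) * (2 * M.a * Real.sin (x 2) * Real.cos (x 2) / M.E)
          * (v 2 * w 3 - w 2 * v 3) := by
  have hU := M.U_pos hr (x 2)
  have d1 := (M.hasDerivAt_Δr (x 1)).sqrt_div (M.hasDerivAt_U_left (x 1) (x 2)) hΔ hU
  have d2 := (hasDerivAt_const (x 2) (M.Δr (x 1))).sqrt_div (M.hasDerivAt_U_right (x 1) (x 2)) hΔ hU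
  have d3 : HasDerivAt (fun θ => -(M.a * Real.sin θ ^ 2 / M.E))
      (-(2 * M.a * Real.sin (x 2) * Real.cos (x 2) / M.E)) (x 2) :=
    ((((Real.hasDerivAt_sin (x 2)).fun_pow 2).const_mul M.a).div_const M.E).fun_neg.congr_deriv
      (by simp; ring)
  rw [extDeriv_of_stationary_axisymmetric (θ := M.coframe 0) (x := x)
    (G := fun ν r θ => √(M.Δr r / M.U r θ) *
      (![1, 0, 0, -(M.a * Real.sin θ ^ 2 / M.E)] : Fin 4 → ℝ) ν)
    (fun y ν => rfl)
    (fun ν => d1.mul_const _)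
    -- Both factors of the dφ component depend on θ, so its derivative needs the product rule.
    (g₂ := ![_, 0, 0, _])
    (fun ν => by
      fin_cases ν
      exacts [d2.mul_const 1, by simpa using hasDerivAt_const _ _,
        by simpa using hasDerivAt_const _ _, d2.fun_mul d3])]
  simp only [Fin.sum_univ_four, Real.sqrt_div hΔ.le, Fin.reduceFinMk, Matrix.cons_val]
  have h1 := Real.sqrt_pos.2 hΔ
  have h2 := Real.sqrt_pos.2 hU
  have h3 := Real.sq_sqrt hΔ.le
  have h4 := Real.sq_sqrt hU.le
  -- With the square roots replaced by positive variables of known square, the claim is a rational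
  -- identity.
  generalize √(M.U (x 1) (x 2)) = u at *
  generalize √(M.Δr (x 1)) = h at *
  rw [← h3, ← h4]
  have hE := M.E_pos
  field_simp
  ring

variable {M} in
theorem extDeriv_coframe_one {x : Pt} (hr : 0 < x 1) (hΔ : 0 < M.Δr (x 1)) (v w : Pt) :
    extDeriv (M.coframe 1) x v w
      = -(M.a ^ 2 * Real.cos (x 2) * Real.sin (x 2)) / (√(M.Δr (x 1)) * √(M.U (x 1) (x 2)))
          * (v 2 * w 1 - w 2 * v 1) := by
  have hU := M.U_pos hr (x 2)
  have d1 := (M.hasDerivAt_U_left (x 1) (x 2)).sqrt_div (M.hasDerivAt_Δr (x 1)) hU hΔ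
  have d2 := (M.hasDerivAt_U_right (x 1) (x 2)).sqrt_div (hasDerivAt_const (x 2) (M.Δr (x 1))) hU hΔ
  rw [extDeriv_of_stationary_axisymmetric (θ := M.coframe 1) (x := x)
    (G := fun ν r θ => √(M.U r θ / M.Δr r) * (![0, 1, 0, 0] : Fin 4 → ℝ) ν)
    (fun y ν => rfl) (fun ν => d1.mul_const _) (fun ν => d2.mul_const _)]
  simp only [Fin.sum_univ_four, Matrix.cons_val]
  have h1 := Real.sqrt_pos.2 hΔ
  have h2 := Real.sqrt_pos.2 hU
  have h3 := Real.sq_sqrt hΔ.le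
  have h4 := Real.sq_sqrt hU.le
  generalize √(M.U (x 1) (x 2)) = u at *
  generalize √(M.Δr (x 1)) = h at *
  rw [← h3, ← h4]
  field_simp
  ring

variable {M} in
theorem extDeriv_coframe_two {x : Pt} (hr : 0 < x 1) (v w : Pt) :
    extDeriv (M.coframe 2) x v w
      = x 1 / (√(M.Δθ (x 2)) * √(M.U (x 1) (x 2))) * (v 1 * w 2 - w 1 * v 2) := by
  have hU := M.U_pos hr (x 2)
  have hΔ := M.Δθ_pos (x 2)
  have d1 := (M.hasDerivAt_U_left (x 1) (x 2)).sqrt_div (hasDerivAt_const (x 1) (M.Δθ (x 2))) hU hΔ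
  have d2 := (M.hasDerivAt_U_right (x 1) (x 2)).sqrt_div (M.hasDerivAt_Δθ (x 2)) hU hΔ
  rw [extDeriv_of_stationary_axisymmetric (θ := M.coframe 2) (x := x)
    (G := fun ν r θ => √(M.U r θ / M.Δθ θ) * (![0, 0, 1, 0] : Fin 4 → ℝ) ν)
    (fun y ν => rfl) (fun ν => d1.mul_const _) (fun ν => d2.mul_const _)]
  simp only [Fin.sum_univ_four, Matrix.cons_val]
  have h1 := Real.sqrt_pos.2 hΔ
  have h2 := Real.sqrt_pos.2 hU
  have h3 := Real.sq_sqrt hΔ.le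
  have h4 := Real.sq_sqrt hU.le
  generalize √(M.U (x 1) (x 2)) = u at *
  generalize √(M.Δθ (x 2)) = h at *
  rw [← h3, ← h4]
  field_simp
  ring

-- The bracket Δ_+(θ) - κ²U arises because ∂_θ Δ_+(θ) = κ² ∂_θ U, so the derivative of the quotient
-- Δ_+(θ)/U has a common factor ∂_θ U.
variable {M} in
theorem extDeriv_coframe_three {x : Pt} (hr : 0 < x 1) (v w : Pt) :
    extDeriv (M.coframe 3) x v w
      = -(√(M.Δθ (x 2)) * x 1 * Real.sin (x 2)) / √(M.U (x 1) (x 2)) ^ 3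
          * (M.a * (v 1 * w 0 - w 1 * v 0)
            - (x 1 ^ 2 + M.a ^ 2) / M.E * (v 1 * w 3 - w 1 * v 3))
        + (M.a ^ 2 * Real.cos (x 2) * Real.sin (x 2) ^ 2
            * (√(M.Δθ (x 2)) ^ 2 - M.κ ^ 2 * √(M.U (x 1) (x 2)) ^ 2)
            / (√(M.Δθ (x 2)) * √(M.U (x 1) (x 2)) ^ 3)
          + √(M.Δθ (x 2)) / √(M.U (x 1) (x 2)) * Real.cos (x 2))
          * (M.a * (v 2 * w 0 - w 2 * v 0)
            - (x 1 ^ 2 + M.a ^ 2) / M.E * (v 2 * w 3 - w 2 * v 3))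
        - √(M.Δθ (x 2)) / √(M.U (x 1) (x 2)) * Real.sin (x 2) * (2 * x 1 / M.E)
          * (v 1 * w 3 - w 1 * v 3) := by
  have hU := M.U_pos hr (x 2)
  have hΔ := M.Δθ_pos (x 2)
  have d1 := ((hasDerivAt_const (x 1) (M.Δθ (x 2))).sqrt_div (M.hasDerivAt_U_left (x 1) (x 2))
    hΔ hU).mul_const (Real.sin (x 2))
  have d2 := ((M.hasDerivAt_Δθ (x 2)).sqrt_div (M.hasDerivAt_U_right (x 1) (x 2)) hΔ hU).fun_mul
    (Real.hasDerivAt_sin (x 2))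
  have d3 : HasDerivAt (fun r : ℝ => -((r ^ 2 + M.a ^ 2) / M.E)) (-(2 * x 1 / M.E)) (x 1) :=
    ((((hasDerivAt_id (x 1)).fun_pow 2).add_const _).div_const M.E).fun_neg.congr_deriv (by simp)
  rw [extDeriv_of_stationary_axisymmetric (θ := M.coframe 3) (x := x)
    (G := fun ν r θ => √(M.Δθ θ / M.U r θ) * Real.sin θ *
      (![M.a, 0, 0, -((r ^ 2 + M.a ^ 2) / M.E)] : Fin 4 → ℝ) ν)
    (fun y ν => rfl)
    (g₁ := ![_, 0, 0, _])
    (fun ν => by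
      fin_cases ν
      exacts [d1.mul_const M.a, by simpa using hasDerivAt_const _ _,
        by simpa using hasDerivAt_const _ _, d1.fun_mul d3])
    (fun ν => d2.mul_const _)]
  simp only [Fin.sum_univ_four, Real.sqrt_div hΔ.le, Fin.reduceFinMk, Matrix.cons_val]
  have h1 := Real.sqrt_pos.2 hΔ
  have h2 := Real.sqrt_pos.2 hU
  have h3 := Real.sq_sqrt hΔ.le
  have h4 := Real.sq_sqrt hU.le
  generalize √(M.U (x 1) (x 2)) = u at *
  generalize √(M.Δθ (x 2)) = h at *
  rw [← h3, ← h4]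
  have hE := M.E_pos
  field_simp
  ring

end KNdS

/-! ### Structure functions of the orthonormal frame -/

namespace KNdS

variable {M : KNdS} {x : Pt}

theorem frame_zero (hr : 0 < x 1) :
    M.frame 0 x = ![(x 1 ^ 2 + M.a ^ 2) / (√(M.U (x 1) (x 2)) * √(M.Δr (x 1))), 0, 0,
      M.a * M.E / (√(M.U (x 1) (x 2)) * √(M.Δr (x 1)))] := by
  have h : x 1 ^ 2 + M.a ^ 2 ≠ 0 := by positivity
  ext ν
  fin_cases ν <;> simp [frame, Real.sqrt_mul (M.U_pos hr (x 2)).le]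
  field_simp

theorem frame_one (hΔ : 0 < M.Δr (x 1)) :
    M.frame 1 x = ![0, √(M.Δr (x 1)) / √(M.U (x 1) (x 2)), 0, 0] := by
  ext ν
  fin_cases ν <;> simp [frame, Real.sqrt_div hΔ.le]

theorem frame_two :
    M.frame 2 x = ![0, 0, √(M.Δθ (x 2)) / √(M.U (x 1) (x 2)), 0] := by
  ext ν
  fin_cases ν <;> simp [frame, Real.sqrt_div (M.Δθ_pos (x 2)).le]

theorem frame_three (hr : 0 < x 1) :
    M.frame 3 x = ![-(M.a * Real.sin (x 2)) / (√(M.U (x 1) (x 2)) * √(M.Δθ (x 2))), 0, 0,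
      -M.E / (√(M.U (x 1) (x 2)) * √(M.Δθ (x 2)) * Real.sin (x 2))] := by
  ext ν
  fin_cases ν <;> simp [frame, Real.sqrt_mul (M.U_pos hr (x 2)).le] <;> field_simp

/-- The form dt - (a sin²θ/E_+) dφ annihilates e_3. Hence the terms that differentiate its
coefficient vanish on (e_1, e_3) and (e_2, e_3), and only the derivative of sin²θ contributes to the
latter. The remaining values simplify by U = r² + a² - a² sin²θ. -/
theorem structure_zero (hr : 0 < x 1) (hΔ : 0 < M.Δr (x 1)) (hs : 0 < Real.sin (x 2)) :
    extDeriv (M.coframe 0) x (M.frame 0 x) (M.frame 1 x)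
        = (2 * x 1 * √(M.Δr (x 1)) ^ 2 - M.Δr' (x 1) * √(M.U (x 1) (x 2)) ^ 2)
          / (2 * √(M.Δr (x 1)) * √(M.U (x 1) (x 2)) ^ 3) ∧
      extDeriv (M.coframe 0) x (M.frame 0 x) (M.frame 2 x)
        = M.a ^ 2 * Real.cos (x 2) * Real.sin (x 2) * √(M.Δθ (x 2)) / √(M.U (x 1) (x 2)) ^ 3 ∧
      extDeriv (M.coframe 0) x (M.frame 0 x) (M.frame 3 x) = 0 ∧
      extDeriv (M.coframe 0) x (M.frame 1 x) (M.frame 2 x) = 0 ∧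
      extDeriv (M.coframe 0) x (M.frame 1 x) (M.frame 3 x) = 0 ∧
      extDeriv (M.coframe 0) x (M.frame 2 x) (M.frame 3 x)
        = 2 * M.a * Real.cos (x 2) * √(M.Δr (x 1)) / √(M.U (x 1) (x 2)) ^ 3 := by
  simp only [extDeriv_coframe_zero hr hΔ, frame_zero hr, frame_one hΔ, frame_two, frame_three hr]
  have h1 := Real.sqrt_pos.2 hΔ
  have h2 := Real.sqrt_pos.2 (M.U_pos hr (x 2))
  have h3 := Real.sqrt_pos.2 (M.Δθ_pos (x 2))
  have h4 : √(M.U (x 1) (x 2)) ^ 2 = x 1 ^ 2 + M.a ^ 2 * Real.cos (x 2) ^ 2 :=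
    Real.sq_sqrt (M.U_pos hr (x 2)).le
  have h5 := Real.sin_sq_add_cos_sq (x 2)
  have hE := M.E_pos
  generalize √(M.U (x 1) (x 2)) = u at *
  generalize √(M.Δr (x 1)) = h at *
  generalize √(M.Δθ (x 2)) = q at *
  generalize Real.sin (x 2) = s at *
  generalize Real.cos (x 2) = c at *
  generalize M.E = E at *
  refine ⟨?_, ?_, ?_, ?_, ?_, ?_⟩ <;> simp <;> field_simp
  · grind
  · grind
  · simp
  · ring

theorem structure_one (hr : 0 < x 1) (hΔ : 0 < M.Δr (x 1)) :
    extDeriv (M.coframe 1) x (M.frame 0 x) (M.frame 1 x) = 0 ∧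
      extDeriv (M.coframe 1) x (M.frame 0 x) (M.frame 2 x) = 0 ∧
      extDeriv (M.coframe 1) x (M.frame 0 x) (M.frame 3 x) = 0 ∧
      extDeriv (M.coframe 1) x (M.frame 1 x) (M.frame 2 x)
        = M.a ^ 2 * Real.cos (x 2) * Real.sin (x 2) * √(M.Δθ (x 2)) / √(M.U (x 1) (x 2)) ^ 3 ∧
      extDeriv (M.coframe 1) x (M.frame 1 x) (M.frame 3 x) = 0 ∧
      extDeriv (M.coframe 1) x (M.frame 2 x) (M.frame 3 x) = 0 := by
  simp only [extDeriv_coframe_one hr hΔ, frame_zero hr, frame_one hΔ, frame_two, frame_three hr]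
  have h1 := Real.sqrt_pos.2 hΔ
  have h2 := Real.sqrt_pos.2 (M.U_pos hr (x 2))
  refine ⟨?_, ?_, ?_, ?_, ?_, ?_⟩ <;> simp
  field_simp

theorem structure_two (hr : 0 < x 1) (hΔ : 0 < M.Δr (x 1)) :
    extDeriv (M.coframe 2) x (M.frame 0 x) (M.frame 1 x) = 0 ∧
      extDeriv (M.coframe 2) x (M.frame 0 x) (M.frame 2 x) = 0 ∧
      extDeriv (M.coframe 2) x (M.frame 0 x) (M.frame 3 x) = 0 ∧
      extDeriv (M.coframe 2) x (M.frame 1 x) (M.frame 2 x)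
        = x 1 * √(M.Δr (x 1)) / √(M.U (x 1) (x 2)) ^ 3 ∧
      extDeriv (M.coframe 2) x (M.frame 1 x) (M.frame 3 x) = 0 ∧
      extDeriv (M.coframe 2) x (M.frame 2 x) (M.frame 3 x) = 0 := by
  simp only [extDeriv_coframe_two hr, frame_zero hr, frame_one hΔ, frame_two, frame_three hr]
  have h1 := Real.sqrt_pos.2 (M.Δθ_pos (x 2))
  have h2 := Real.sqrt_pos.2 (M.U_pos hr (x 2))
  refine ⟨?_, ?_, ?_, ?_, ?_, ?_⟩ <;> simp
  field_simp

/-- Dually to e^0, the form a dt - ((r² + a²)/E_+) dφ annihilates e_0, so the value on (e_0, e_2) is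
zero and only the derivative of r² + a² contributes on (e_0, e_1). -/
theorem structure_three (hr : 0 < x 1) (hΔ : 0 < M.Δr (x 1)) (hs : 0 < Real.sin (x 2)) :
    extDeriv (M.coframe 3) x (M.frame 0 x) (M.frame 1 x)
        = 2 * M.a * x 1 * Real.sin (x 2) * √(M.Δθ (x 2)) / √(M.U (x 1) (x 2)) ^ 3 ∧
      extDeriv (M.coframe 3) x (M.frame 0 x) (M.frame 2 x) = 0 ∧
      extDeriv (M.coframe 3) x (M.frame 0 x) (M.frame 3 x) = 0 ∧
      extDeriv (M.coframe 3) x (M.frame 1 x) (M.frame 2 x) = 0 ∧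
      extDeriv (M.coframe 3) x (M.frame 1 x) (M.frame 3 x)
        = x 1 * √(M.Δr (x 1)) / √(M.U (x 1) (x 2)) ^ 3 ∧
      extDeriv (M.coframe 3) x (M.frame 2 x) (M.frame 3 x)
        = M.a ^ 2 * Real.cos (x 2) * Real.sin (x 2)
            * (√(M.Δθ (x 2)) ^ 2 - M.κ ^ 2 * √(M.U (x 1) (x 2)) ^ 2)
            / (√(M.Δθ (x 2)) * √(M.U (x 1) (x 2)) ^ 3)
          + √(M.Δθ (x 2)) * Real.cos (x 2) / (√(M.U (x 1) (x 2)) * Real.sin (x 2)) := by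
  simp only [extDeriv_coframe_three hr, frame_zero hr, frame_one hΔ, frame_two, frame_three hr]
  have h1 := Real.sqrt_pos.2 hΔ
  have h2 := Real.sqrt_pos.2 (M.U_pos hr (x 2))
  have h3 := Real.sqrt_pos.2 (M.Δθ_pos (x 2))
  have h4 : √(M.U (x 1) (x 2)) ^ 2 = x 1 ^ 2 + M.a ^ 2 * Real.cos (x 2) ^ 2 :=
    Real.sq_sqrt (M.U_pos hr (x 2)).le
  have h5 := Real.sin_sq_add_cos_sq (x 2)
  have hE := M.E_pos
  generalize √(M.U (x 1) (x 2)) = u at *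
  generalize √(M.Δr (x 1)) = h at *
  generalize √(M.Δθ (x 2)) = q at *
  generalize Real.sin (x 2) = s at *
  generalize Real.cos (x 2) = c at *
  generalize M.E = E at *
  refine ⟨?_, ?_, ?_, ?_, ?_, ?_⟩ <;> simp <;> field_simp
  · ring
  · simp
  · grind
  · have h6 : s ^ 2 = 1 - c ^ 2 := by linarith
    have h7 : x 1 ^ 2 = u ^ 2 - M.a ^ 2 * c ^ 2 := by linarith
    rw [h7]
    linear_combination (-(M.a^2*q^2*c*u^2) - c * s^2 * M.a^4 * (q^2-M.κ^2*u^2)) * h5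

end KNdS

/-! ### The Dirac operator in terms of structure functions -/

namespace DiracChart

theorem gam_zero_mulVec (ψ : Fin 4 → ℂ) : gam 0 *ᵥ ψ = ![-ψ 2, -ψ 3, -ψ 0, -ψ 1] := by
  ext i; fin_cases i <;> simp [gam, Matrix.mulVec, dotProduct, Fin.sum_univ_four]

theorem gam_one_mulVec (ψ : Fin 4 → ℂ) : gam 1 *ᵥ ψ = ![-ψ 2, ψ 3, ψ 0, -ψ 1] := by
  ext i; fin_cases i <;> simp [gam, Matrix.mulVec, dotProduct, Fin.sum_univ_four]

theorem gam_two_mulVec (ψ : Fin 4 → ℂ) : gam 2 *ᵥ ψ = ![ψ 3, ψ 2, -ψ 1, -ψ 0] := by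
  ext i; fin_cases i <;> simp [gam, Matrix.mulVec, dotProduct, Fin.sum_univ_four]

theorem gam_three_mulVec (ψ : Fin 4 → ℂ) :
    gam 3 *ᵥ ψ
      = ![Complex.I * ψ 3, -(Complex.I * ψ 2), -(Complex.I * ψ 1), Complex.I * ψ 0] := by
  ext i; fin_cases i <;> simp [gam, Matrix.mulVec, dotProduct, Fin.sum_univ_four]

theorem spinNabla_eq (co fr : Fin 4 → Pt → Pt) (α : Fin 4) (Ψ : Pt → Fin 4 → ℂ) (x : Pt) :
    spinNabla co fr α Ψ x = (∑ μ, ((fr α x μ : ℝ) : ℂ) • pd μ Ψ x)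
      - (1 / 2 : ℂ) •
        (((conn co fr 0 1 α x : ℝ) : ℂ) • (gam 0 *ᵥ (gam 1 *ᵥ Ψ x))
        + ((conn co fr 0 2 α x : ℝ) : ℂ) • (gam 0 *ᵥ (gam 2 *ᵥ Ψ x))
        + ((conn co fr 0 3 α x : ℝ) : ℂ) • (gam 0 *ᵥ (gam 3 *ᵥ Ψ x))
        + ((conn co fr 1 2 α x : ℝ) : ℂ) • (gam 1 *ᵥ (gam 2 *ᵥ Ψ x))
        + ((conn co fr 1 3 α x : ℝ) : ℂ) • (gam 1 *ᵥ (gam 3 *ᵥ Ψ x))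
        + ((conn co fr 2 3 α x : ℝ) : ℂ) • (gam 2 *ᵥ (gam 3 *ᵥ Ψ x))) := by
  have i0 : Finset.Ioi (0 : Fin 4) = {1, 2, 3} := by decide
  have i1 : Finset.Ioi (1 : Fin 4) = {2, 3} := by decide
  have i2 : Finset.Ioi (2 : Fin 4) = {3} := by decide
  have i3 : Finset.Ioi (3 : Fin 4) = ∅ := by decide
  simp only [spinNabla, Fin.sum_univ_four (M := Fin 4 → ℂ), i0, i1, i2, i3]
  simp [Matrix.mulVec_mulVec, add_assoc]

/-- The letters are the structure functions C^α_{βγ} = de^α(e_β, e_γ) that need not vanish here. In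
e^α · e^β · e^γ, terms with a repeated index collapse to vectors and give half the traces Σ_α
C^α_{βα}, which are G + H - A for e^1 and J - F - B for e^2. Terms with three distinct indices see
only the totally antisymmetric part, hence only K and L. -/
theorem dirac_eq_of_structure {co fr : Fin 4 → Pt → Pt} {Ψ : Pt → Fin 4 → ℂ} {x : Pt}
    {A B F G H J K L : ℝ}
    (hC : ∀ α β γ, extDeriv (co α) x (fr β x) (fr γ x)
      = (![![![0, A, B, 0], ![-A, 0, 0, 0], ![-B, 0, 0, K], ![0, 0, -K, 0]],
        ![![0, 0, 0, 0], ![0, 0, F, 0], ![0, -F, 0, 0], ![0, 0, 0, 0]],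
        ![![0, 0, 0, 0], ![0, 0, G, 0], ![0, -G, 0, 0], ![0, 0, 0, 0]],
        ![![0, L, 0, 0], ![-L, 0, 0, H], ![0, 0, 0, J], ![0, -H, -J, 0]]] :
          Fin 4 → Fin 4 → Fin 4 → ℝ) α β γ) :
    dirac co fr Ψ x
      = (∑ α, gam α *ᵥ ∑ μ, ((fr α x μ : ℝ) : ℂ) • pd μ Ψ x)
        + ((G + H - A) / 2 : ℂ) • (gam 1 *ᵥ Ψ x) + ((J - F - B) / 2 : ℂ) • (gam 2 *ᵥ Ψ x)
        + ((K / 4 : ℂ) • (gam 0 *ᵥ (gam 2 *ᵥ (gam 3 *ᵥ Ψ x)))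
          - (L / 4 : ℂ) • (gam 0 *ᵥ (gam 1 *ᵥ (gam 3 *ᵥ Ψ x)))) := by
  have h01 : ∀ α, conn co fr 0 1 α x = (![A, 0, 0, -L / 2] : Fin 4 → ℝ) α := by
    intro α; fin_cases α <;> simp [conn, hC, eta]
  have h02 : ∀ α, conn co fr 0 2 α x = (![B, 0, 0, -K / 2] : Fin 4 → ℝ) α := by
    intro α; fin_cases α <;> simp [conn, hC, eta]
  have h03 : ∀ α, conn co fr 0 3 α x = (![0, -L / 2, K / 2, 0] : Fin 4 → ℝ) α := by
    intro α; fin_cases α <;> simp [conn, hC, eta]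
  have h12 : ∀ α, conn co fr 1 2 α x = (![0, -F, -G, 0] : Fin 4 → ℝ) α := by
    intro α; fin_cases α <;> simp [conn, hC, eta] <;> ring
  have h13 : ∀ α, conn co fr 1 3 α x = (![L / 2, 0, 0, -H] : Fin 4 → ℝ) α := by
    intro α; fin_cases α <;> simp [conn, hC, eta] <;> ring
  have h23 : ∀ α, conn co fr 2 3 α x = (![K / 2, 0, 0, -J] : Fin 4 → ℝ) α := by
    intro α; fin_cases α <;> simp [conn, hC, eta] <;> ring
  simp only [dirac, spinNabla_eq, h01, h02, h03, h12, h13, h23]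
  -- The derivative terms agree on both sides; abstracting them leaves pure Clifford algebra in the
  -- value of the spinor.
  generalize hV : (fun α => ∑ μ, ((fr α x μ : ℝ) : ℂ) • pd μ Ψ x) = V
  replace hV : ∀ α, ∑ μ, ((fr α x μ : ℝ) : ℂ) • pd μ Ψ x = V α := fun α => congrFun hV α
  simp only [hV, Matrix.mulVec_sub]
  rw [Finset.sum_sub_distrib, sub_eq_add_neg, add_assoc, add_assoc]
  congr 1
  generalize Ψ x = ψ
  simp only [Fin.sum_univ_four, Matrix.mulVec_add, Matrix.mulVec_smul, gam_zero_mulVec,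
    gam_one_mulVec, gam_two_mulVec, gam_three_mulVec, Matrix.cons_val]
  ext i
  fin_cases i <;> simp <;> ring_nf <;> simp only [Complex.I_sq] <;> ring

end DiracChart

/-! ### Square roots of r ± ia cos θ -/

/-- The square root of `r + i b cos θ`. -/
noncomputable def rootFactor (b r θ : ℝ) : ℂ :=
  ((r : ℂ) + Complex.I * b * Real.cos θ) ^ (1 / 2 : ℂ)

section rootFactor

variable {b r θ : ℝ}

theorem mem_slitPlane_of_pos (hr : 0 < r) :
    (r : ℂ) + Complex.I * b * Real.cos θ ∈ Complex.slitPlane := by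
  left
  rw [mul_assoc, ← Complex.ofReal_mul]
  simpa using hr

theorem rootFactor_sq : rootFactor b r θ ^ 2 = r + Complex.I * b * Real.cos θ := by
  rw [rootFactor, ← Complex.cpow_nat_mul]
  norm_num

theorem rootFactor_ne_zero (hr : 0 < r) : rootFactor b r θ ≠ 0 := by
  intro h
  have h2 := rootFactor_sq (b := b) (r := r) (θ := θ)
  rw [h] at h2
  have := Complex.slitPlane_ne_zero (mem_slitPlane_of_pos (b := b) (θ := θ) hr)
  exact this (by rw [← h2]; norm_num)

theorem rootFactor_neg (hr : 0 < r) :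
    rootFactor (-b) r θ = (starRingEnd ℂ) (rootFactor b r θ) := by
  have h := Complex.slitPlane_arg_ne_pi (mem_slitPlane_of_pos (b := b) (θ := θ) hr)
  have h1 : (starRingEnd ℂ) (1 / 2 : ℂ) = 1 / 2 := by
    rw [map_div₀, map_one, Complex.conj_ofNat]
  have h2 := Complex.cpow_conj _ (1 / 2) h
  rw [h1] at h2
  rw [rootFactor, rootFactor, h2]
  simp [-Complex.ofReal_cos]

theorem norm_rootFactor_sq : ‖rootFactor b r θ‖ ^ 2 = √(r ^ 2 + b ^ 2 * Real.cos θ ^ 2) := by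
  rw [← norm_pow, rootFactor_sq, Complex.norm_def, mul_assoc, ← Complex.ofReal_mul]
  congr 1
  simp [Complex.normSq_apply, -Complex.ofReal_cos]
  ring

/-- This factorisation of √U makes the components of the Dirac equation rational in the two complex
roots, so that they can be compared by algebra. -/
theorem rootFactor_mul_rootFactor_neg (hr : 0 < r) :
    rootFactor b r θ * rootFactor (-b) r θ = (√(r ^ 2 + b ^ 2 * Real.cos θ ^ 2) : ℝ) := by
  rw [rootFactor_neg hr, Complex.mul_conj, Complex.normSq_eq_norm_sq, norm_rootFactor_sq]

theorem hasDerivAt_cpow_half {f : ℝ → ℂ} {f' : ℂ} {x : ℝ} (hf : HasDerivAt f f' x)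
    (h : f x ∈ Complex.slitPlane) :
    HasDerivAt (fun s => f s ^ (1 / 2 : ℂ)) (f' / (2 * f x ^ (1 / 2 : ℂ))) x := by
  have h0 := Complex.slitPlane_ne_zero h
  have h1 : f x ^ (1 / 2 : ℂ) ≠ 0 := by
    rw [Ne, Complex.cpow_eq_zero_iff]
    simp [h0]
  have h2 : (f x ^ (1 / 2 : ℂ)) ^ 2 = f x := by
    rw [← Complex.cpow_nat_mul]; norm_num
  have h3 := (hasDerivAt_id (f x)).cpow_const (c := (1 / 2 : ℂ)) h
  refine (h3.comp x hf).congr_deriv ?_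
  simp only [id]
  rw [Complex.cpow_sub _ _ h0, Complex.cpow_one, mul_one]
  nth_rewrite 2 [← h2]
  field_simp

theorem hasDerivAt_rootFactor_left (hr : 0 < r) :
    HasDerivAt (fun s => rootFactor b s θ) (1 / (2 * rootFactor b r θ)) r :=
  hasDerivAt_cpow_half (Complex.ofRealCLM.hasDerivAt.add_const _) (mem_slitPlane_of_pos hr)

theorem hasDerivAt_rootFactor_right (hr : 0 < r) :
    HasDerivAt (fun s => rootFactor b r s)
      (-(Complex.I * b * Real.sin θ) / (2 * rootFactor b r θ)) θ := by
  have h : HasDerivAt (fun s : ℝ => (r : ℂ) + Complex.I * b * Real.cos s)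
      (-(Complex.I * b * Real.sin θ)) θ := by
    have := ((Real.hasDerivAt_cos θ).ofReal_comp.const_mul (Complex.I * b)).const_add (r : ℂ)
    simpa using this
  exact hasDerivAt_cpow_half h (mem_slitPlane_of_pos hr)

end rootFactor

/-! ### Components of a separated spinor -/

namespace KNdS

variable {M : KNdS} {rm rp ω : ℝ} {k : ℤ} {Xp Xm Yp Ym : ℝ → ℂ} {Ψ : Pt → Fin 4 → ℂ}

/-- The phase `e^{-i(ωt + (k+½)φ)}`. -/
noncomputable def phase (ω : ℝ) (k : ℤ) (t φ : ℝ) : ℂ :=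
  Complex.exp (-Complex.I * ((ω * t + (k + 1 / 2) * φ : ℝ) : ℂ))

theorem phase_ne_zero (t φ : ℝ) : phase ω k t φ ≠ 0 := Complex.exp_ne_zero _

theorem norm_phase (t φ : ℝ) : ‖phase ω k t φ‖ = 1 := by
  rw [phase, neg_mul, mul_comm, ← neg_mul, ← Complex.ofReal_neg, Complex.norm_exp_ofReal_mul_I]

theorem hasDerivAt_phase_left (t φ : ℝ) :
    HasDerivAt (fun s => phase ω k s φ) (-Complex.I * ω * phase ω k t φ) t := by
  have h : HasDerivAt (fun s : ℝ => ω * s + (k + 1 / 2) * φ) ω t := by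
    simpa using ((hasDerivAt_id t).const_mul ω).add_const ((k + 1 / 2) * φ)
  exact (h.ofReal_comp.const_mul (-Complex.I)).cexp.congr_deriv (by rw [phase]; ring)

theorem hasDerivAt_phase_right (t φ : ℝ) :
    HasDerivAt (fun s => phase ω k t s) (-Complex.I * (k + 1 / 2) * phase ω k t φ) φ := by
  have h : HasDerivAt (fun s : ℝ => ω * t + (k + 1 / 2) * s) (k + 1 / 2) φ := by
    simpa using ((hasDerivAt_id φ).const_mul ((k : ℝ) + 1 / 2)).const_add (ω * t)
  exact (h.ofReal_comp.const_mul (-Complex.I)).cexp.congr_deriv (by rw [phase]; push_cast; ring)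

/-- The factor `Δ_+(r)^{1/4}` of the matrix `S_+`. -/
noncomputable def quarter (M : KNdS) (r : ℝ) : ℂ := ((M.Δr r ^ (1 / 4 : ℝ) : ℝ) : ℂ)

theorem quarter_ne_zero {r : ℝ} (h : 0 < M.Δr r) : M.quarter r ≠ 0 :=
  Complex.ofReal_ne_zero.2 (Real.rpow_pos_of_pos h _).ne'

theorem hasDerivAt_quarter {r : ℝ} (h : 0 < M.Δr r) :
    HasDerivAt M.quarter (M.Δr' r / (4 * M.Δr r) * M.quarter r) r := by
  refine ((M.hasDerivAt_Δr r).rpow_const (p := 1 / 4) (Or.inl h.ne')).ofReal_comp.congr_deriv ?_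
  rw [Real.rpow_sub h, Real.rpow_one, quarter]
  have : (M.Δr r : ℂ) ≠ 0 := Complex.ofReal_ne_zero.2 h.ne'
  push_cast
  field_simp

theorem inv_S {r θ : ℝ} (hr : 0 < r) (h : 0 < M.Δr r) :
    (M.S r θ)⁻¹ = Matrix.diagonal ![(M.quarter r * rootFactor M.a r θ)⁻¹,
      (M.quarter r * rootFactor M.a r θ)⁻¹, (M.quarter r * rootFactor (-M.a) r θ)⁻¹,
      (M.quarter r * rootFactor (-M.a) r θ)⁻¹] := by
  apply Matrix.inv_eq_right_inv
  have h1 := rootFactor_ne_zero (b := M.a) (θ := θ) hr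
  have h2 := rootFactor_ne_zero (b := -M.a) (θ := θ) hr
  have h3 := quarter_ne_zero h
  have e1 : ((r : ℂ) + Complex.I * M.a * Real.cos θ) ^ (1 / 2 : ℂ) = rootFactor M.a r θ := rfl
  have e2 : ((r : ℂ) - Complex.I * M.a * Real.cos θ) ^ (1 / 2 : ℂ) = rootFactor (-M.a) r θ := by
    rw [rootFactor]; push_cast; ring_nf
  rw [S, e1, e2, ← quarter, Matrix.smul_mul, Matrix.diagonal_mul_diagonal, ← Matrix.diagonal_smul,
    ← Matrix.diagonal_one]
  congr 1
  ext i
  fin_cases i <;> simp <;> field_simp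

/-- The components of a separated spinor. -/
theorem IsSeparated.apply (hsep : M.IsSeparated rm rp ω k Xp Xm Yp Ym Ψ) {x : Pt}
    (hx : x ∈ exterior rm rp) (hr : 0 < x 1) (h : 0 < M.Δr (x 1)) (i : Fin 4) :
    Ψ x i = phase ω k (x 0) (x 3)
        * ((![Xm, Xp, Xp, Xm] : Fin 4 → ℝ → ℂ) i (x 1)
          * (![Ym, Yp, Ym, Yp] : Fin 4 → ℝ → ℂ) i (x 2))
      / (M.quarter (x 1) * rootFactor ((![M.a, M.a, -M.a, -M.a] : Fin 4 → ℝ) i) (x 1) (x 2)) := by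
  rw [hsep x hx, inv_S hr h, Phi, ← phase, Matrix.mulVec_diagonal]
  fin_cases i <;> simp <;> ring

end KNdS

/-! ### Factorisation of Δ_+(r) and derivatives of the separated spinor -/

namespace KNdS

open Polynomial in
theorem ΔPoly_eq (M : KNdS) :
    M.ΔPoly = C (-M.κ ^ 2) * X ^ 4 + C (1 - M.κ ^ 2 * M.a ^ 2) * X ^ 2 + C (-(2 * M.m)) * X
      + C (M.a ^ 2 + M.Q ^ 2 + M.P ^ 2) := by
  simp only [ΔPoly, map_neg, map_add, map_sub, map_mul, map_pow, map_one]
  ring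

open Polynomial in
theorem natDegree_ΔPoly (M : KNdS) : M.ΔPoly.natDegree = 4 := by
  have := M.κ_pos
  rw [ΔPoly_eq]
  compute_degree!
  exact this.ne'

open Polynomial in
theorem leadingCoeff_ΔPoly (M : KNdS) : M.ΔPoly.leadingCoeff = -M.κ ^ 2 := by
  rw [leadingCoeff, natDegree_ΔPoly, ΔPoly_eq]
  simp only [coeff_add, coeff_C_mul, coeff_X_pow, coeff_X, coeff_C]
  norm_num

variable {M : KNdS} {rm rp : ℝ}

/-- The multiset of roots has as many elements as the degree, so the polynomial splits over ℝ. The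
sign of the leading coefficient -κ² is absorbed in the factor r_+ - r of `B`. -/
theorem IsExtreme.Δr_eq (h : M.IsExtreme rm rp) (r : ℝ) :
    M.Δr r = (r - rm) ^ 2 * M.B rm rp r := by
  have h1 := Polynomial.C_leadingCoeff_mul_prod_multiset_X_sub_C (p := M.ΔPoly)
    (by rw [h.roots_eq, natDegree_ΔPoly]; rfl)
  rw [← eval_ΔPoly, ← h1, leadingCoeff_ΔPoly, h.roots_eq]
  simp [B]
  ring

theorem IsExtreme.B_pos (h : M.IsExtreme rm rp) {r : ℝ} (hr : r ∈ Set.Ico rm rp) :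
    0 < M.B rm rp r := by
  have := M.κ_pos
  have h1 := h.rm_pos
  have h2 : 0 < rp - r := by linarith [hr.2]
  have h3 : 0 < r + rp + 2 * rm := by linarith [hr.1, hr.2]
  unfold B
  positivity

theorem IsExtreme.Δr_pos (h : M.IsExtreme rm rp) {r : ℝ} (hr : r ∈ Set.Ioo rm rp) :
    0 < M.Δr r := by
  rw [h.Δr_eq]
  exact mul_pos (pow_pos (by linarith [hr.1]) 2) (h.B_pos ⟨hr.1.le, hr.2⟩)

theorem IsExtreme.pos (h : M.IsExtreme rm rp) {r : ℝ} (hr : r ∈ Set.Ioo rm rp) : 0 < r :=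
  h.rm_pos.trans hr.1

variable {ω : ℝ} {k : ℤ} {Xp Xm Yp Ym : ℝ → ℂ} {Ψ : Pt → Fin 4 → ℂ}

/-- The radial factors of the four components. -/
def radialFactor (Xp Xm : ℝ → ℂ) : Fin 4 → ℝ → ℂ := ![Xm, Xp, Xp, Xm]

/-- The angular factors of the four components. -/
def angularFactor (Yp Ym : ℝ → ℂ) : Fin 4 → ℝ → ℂ := ![Ym, Yp, Ym, Yp]

/-- The signed rotation parameter in the four entries of `S_+`. -/
def signedRotation (M : KNdS) : Fin 4 → ℝ := ![M.a, M.a, -M.a, -M.a]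

/-- `S_+^{-1} Φ` as a function of the four coordinates. -/
noncomputable def separatedSpinor (M : KNdS) (ω : ℝ) (k : ℤ) (Xp Xm Yp Ym : ℝ → ℂ) (i : Fin 4)
    (t r θ φ : ℝ) : ℂ :=
  phase ω k t φ * (radialFactor Xp Xm i r * angularFactor Yp Ym i θ)
    / (M.quarter r * rootFactor (M.signedRotation i) r θ)

theorem IsSeparated.apply_eq (hsep : M.IsSeparated rm rp ω k Xp Xm Yp Ym Ψ)
    (h : M.IsExtreme rm rp) {x : Pt} (hx : x ∈ exterior rm rp) (i : Fin 4) :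
    Ψ x i = M.separatedSpinor ω k Xp Xm Yp Ym i (x 0) (x 1) (x 2) (x 3) :=
  hsep.apply hx (h.pos hx.1) (h.Δr_pos hx.1) i

theorem isOpen_exterior : IsOpen (exterior rm rp) :=
  (isOpen_Ioo.preimage (continuous_apply 1)).inter (isOpen_Ioo.preimage (continuous_apply 2))

theorem differentiableAt_update (hd : DifferentiableOn ℝ Ψ (exterior rm rp)) {x : Pt}
    (hx : x ∈ exterior rm rp) (μ i : Fin 4) :
    DifferentiableAt ℝ (fun s => Ψ (Function.update x μ s) i) (x μ) := by
  have h1 := (hd x hx).differentiableAt (isOpen_exterior.mem_nhds hx)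
  have h2 : DifferentiableAt ℝ (fun s => Function.update x μ s) (x μ) :=
    (hasDerivAt_update x μ (x μ)).differentiableAt
  have h3 : DifferentiableAt ℝ Ψ (Function.update x μ (x μ)) := by simpa using h1
  exact (differentiableAt_pi.1 (h3.comp (x μ) h2)) i

theorem IsSeparated.update_eventuallyEq (hsep : M.IsSeparated rm rp ω k Xp Xm Yp Ym Ψ)
    (h : M.IsExtreme rm rp) {x : Pt} (hx : x ∈ exterior rm rp) (μ i : Fin 4) :
    (fun s => Ψ (Function.update x μ s) i) =ᶠ[nhds (x μ)] fun s =>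
      M.separatedSpinor ω k Xp Xm Yp Ym i (Function.update x μ s 0) (Function.update x μ s 1)
        (Function.update x μ s 2) (Function.update x μ s 3) := by
  have h1 : Continuous fun s => Function.update x μ s := continuous_const.update μ continuous_id
  have h2 : Function.update x μ (x μ) ∈ exterior rm rp := by simpa using hx
  filter_upwards [h1.continuousAt.preimage_mem_nhds (isOpen_exterior.mem_nhds h2)] with s hs
  exact hsep.apply_eq h hs i

/-- Differentiability is assumed for Ψ only. Along a line θ = const on which the angular factor is
nonzero, the radial factor is Ψ times explicit differentiable functions of r. -/
theorem IsSeparated.differentiableAt_radial (hsep : M.IsSeparated rm rp ω k Xp Xm Yp Ym Ψ)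
    (h : M.IsExtreme rm rp) (hd : DifferentiableOn ℝ Ψ (exterior rm rp)) {r θ : ℝ}
    (hr : r ∈ Set.Ioo rm rp) (hθ : θ ∈ Set.Ioo 0 Real.pi) (i : Fin 4)
    (hY : angularFactor Yp Ym i θ ≠ 0) : DifferentiableAt ℝ (radialFactor Xp Xm i) r := by
  have hx : ![0, r, θ, 0] ∈ exterior rm rp := ⟨hr, hθ⟩
  have h1 := differentiableAt_update hd hx 1 i
  have h2 := hsep.update_eventuallyEq h hx 1 i
  simp only [Matrix.cons_val] at h1 h2
  have h3 := ((h1.mul (hasDerivAt_quarter (h.Δr_pos hr)).differentiableAt).mul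
    (hasDerivAt_rootFactor_left (b := M.signedRotation i) (θ := θ) (h.pos hr)).differentiableAt
    ).div_const (phase ω k 0 0 * angularFactor Yp Ym i θ)
  refine h3.congr_of_eventuallyEq ?_
  filter_upwards [h2, isOpen_Ioo.mem_nhds hr] with s hs hs'
  have n1 := quarter_ne_zero (h.Δr_pos hs')
  have n2 := rootFactor_ne_zero (b := M.signedRotation i) (θ := θ) (h.pos hs')
  have n3 := phase_ne_zero (ω := ω) (k := k) 0 0
  simp only [Pi.mul_apply, hs]
  simp [separatedSpinor]
  field_simp

theorem IsSeparated.differentiableAt_angular (hsep : M.IsSeparated rm rp ω k Xp Xm Yp Ym Ψ)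
    (h : M.IsExtreme rm rp) (hd : DifferentiableOn ℝ Ψ (exterior rm rp)) {r θ : ℝ}
    (hr : r ∈ Set.Ioo rm rp) (hθ : θ ∈ Set.Ioo 0 Real.pi) (i : Fin 4)
    (hX : radialFactor Xp Xm i r ≠ 0) : DifferentiableAt ℝ (angularFactor Yp Ym i) θ := by
  have hx : ![0, r, θ, 0] ∈ exterior rm rp := ⟨hr, hθ⟩
  have h1 := differentiableAt_update hd hx 2 i
  have h2 := hsep.update_eventuallyEq h hx 2 i
  simp only [Matrix.cons_val] at h1 h2
  have h3 := (h1.mul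
    (hasDerivAt_rootFactor_right (b := M.signedRotation i) (θ := θ) (h.pos hr)).differentiableAt
    ).mul_const (M.quarter r / (phase ω k 0 0 * radialFactor Xp Xm i r))
  refine h3.congr_of_eventuallyEq ?_
  filter_upwards [h2] with s hs
  have n1 := quarter_ne_zero (h.Δr_pos hr)
  have n2 := rootFactor_ne_zero (b := M.signedRotation i) (θ := s) (h.pos hr)
  have n3 := phase_ne_zero (ω := ω) (k := k) 0 0
  simp only [Pi.mul_apply, hs]
  simp [separatedSpinor]
  field_simp

theorem pd_apply (hd : DifferentiableOn ℝ Ψ (exterior rm rp)) {x : Pt} (hx : x ∈ exterior rm rp)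
    (μ i : Fin 4) : pd μ Ψ x i = deriv (fun s => Ψ (Function.update x μ s) i) (x μ) := by
  rw [pd, deriv_pi fun i => differentiableAt_update hd hx μ i]

theorem IsSeparated.pd_zero (hsep : M.IsSeparated rm rp ω k Xp Xm Yp Ym Ψ)
    (h : M.IsExtreme rm rp) (hd : DifferentiableOn ℝ Ψ (exterior rm rp)) {x : Pt}
    (hx : x ∈ exterior rm rp) (i : Fin 4) : pd 0 Ψ x i = -Complex.I * ω * Ψ x i := by
  rw [pd_apply hd hx, (hsep.update_eventuallyEq h hx 0 i).deriv_eq, hsep.apply_eq h hx]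
  simp only [separatedSpinor, Function.update_self, ne_eq, Fin.reduceEq, not_false_eq_true,
    Function.update_of_ne]
  rw [(((hasDerivAt_phase_left (x 0) (x 3)).mul_const _).div_const _).deriv]
  ring

theorem IsSeparated.pd_three (hsep : M.IsSeparated rm rp ω k Xp Xm Yp Ym Ψ)
    (h : M.IsExtreme rm rp) (hd : DifferentiableOn ℝ Ψ (exterior rm rp)) {x : Pt}
    (hx : x ∈ exterior rm rp) (i : Fin 4) :
    pd 3 Ψ x i = -Complex.I * (k + 1 / 2) * Ψ x i := by
  rw [pd_apply hd hx, (hsep.update_eventuallyEq h hx 3 i).deriv_eq, hsep.apply_eq h hx]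
  simp only [separatedSpinor, Function.update_self, ne_eq, Fin.reduceEq, not_false_eq_true,
    Function.update_of_ne]
  rw [(((hasDerivAt_phase_right (x 0) (x 3)).mul_const _).div_const _).deriv]
  ring

theorem IsSeparated.pd_one (hsep : M.IsSeparated rm rp ω k Xp Xm Yp Ym Ψ)
    (h : M.IsExtreme rm rp) (hd : DifferentiableOn ℝ Ψ (exterior rm rp)) {x : Pt}
    (hx : x ∈ exterior rm rp) (i : Fin 4)
    (hX : DifferentiableAt ℝ (radialFactor Xp Xm i) (x 1)) :
    pd 1 Ψ x i = phase ω k (x 0) (x 3) / M.quarter (x 1)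
      / rootFactor (M.signedRotation i) (x 1) (x 2)
      * ((deriv (radialFactor Xp Xm i) (x 1) - (M.Δr' (x 1) / (4 * √(M.Δr (x 1)) ^ 2)
        + 1 / (2 * rootFactor (M.signedRotation i) (x 1) (x 2) ^ 2)) * radialFactor Xp Xm i (x 1))
        * angularFactor Yp Ym i (x 2)) := by
  rw [pd_apply hd hx, (hsep.update_eventuallyEq h hx 1 i).deriv_eq]
  simp only [separatedSpinor, Function.update_self, ne_eq, Fin.reduceEq, not_false_eq_true,
    Function.update_of_ne]
  have hΔ := h.Δr_pos hx.1
  have n1 := quarter_ne_zero hΔ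
  have n2 := rootFactor_ne_zero (b := M.signedRotation i) (θ := x 2) (h.pos hx.1)
  have n3 : (M.Δr (x 1) : ℂ) ≠ 0 := Complex.ofReal_ne_zero.2 hΔ.ne'
  have e1 : ((√(M.Δr (x 1)) : ℝ) : ℂ) ^ 2 = M.Δr (x 1) := by
    rw [← Complex.ofReal_pow, Real.sq_sqrt hΔ.le]
  rw [(((hX.hasDerivAt.mul_const _).const_mul _).fun_div ((hasDerivAt_quarter hΔ).fun_mul
    (hasDerivAt_rootFactor_left (h.pos hx.1))) (mul_ne_zero n1 n2)).deriv, e1]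
  field_simp

theorem IsSeparated.pd_two (hsep : M.IsSeparated rm rp ω k Xp Xm Yp Ym Ψ)
    (h : M.IsExtreme rm rp) (hd : DifferentiableOn ℝ Ψ (exterior rm rp)) {x : Pt}
    (hx : x ∈ exterior rm rp) (i : Fin 4)
    (hY : DifferentiableAt ℝ (angularFactor Yp Ym i) (x 2)) :
    pd 2 Ψ x i = phase ω k (x 0) (x 3) / M.quarter (x 1)
      / rootFactor (M.signedRotation i) (x 1) (x 2)
      * (radialFactor Xp Xm i (x 1) * (deriv (angularFactor Yp Ym i) (x 2)
        + Complex.I * M.signedRotation i * Real.sin (x 2)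
          / (2 * rootFactor (M.signedRotation i) (x 1) (x 2) ^ 2)
          * angularFactor Yp Ym i (x 2))) := by
  rw [pd_apply hd hx, (hsep.update_eventuallyEq h hx 2 i).deriv_eq]
  simp only [separatedSpinor, Function.update_self, ne_eq, Fin.reduceEq, not_false_eq_true,
    Function.update_of_ne]
  have hΔ := h.Δr_pos hx.1
  have n1 := quarter_ne_zero hΔ
  have n2 := rootFactor_ne_zero (b := M.signedRotation i) (θ := x 2) (h.pos hx.1)
  rw [(((hY.hasDerivAt.const_mul _).const_mul _).fun_div
    ((hasDerivAt_rootFactor_right (h.pos hx.1)).const_mul _) (mul_ne_zero n1 n2)).deriv]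
  field_simp
  ring

end KNdS

/-! ### The four components of the Dirac equation as algebraic identities -/

section algebra

variable {r a c s q h z zb lam Q P ω l E κ D Xp Xm Yp Ym X' Y' e : ℂ}

/-- Here z and zb are the roots of r ± iac, h and q stand for √Δ_+(r) and √Δ_+(θ), D for Δ_+'(r), l
for k + 1/2, and e for the phase divided by Δ_+(r)^{1/4}. The derivatives of `S` cancel the
connection terms, and the mass term splits through iλ zb² = iλr + aλc into its radial and angular
parts. The three other components follow the same pattern. -/
theorem dirac_component_zero (hz : z ^ 2 = r + Complex.I * a * c)
    (hzb : zb ^ 2 = r - Complex.I * a * c)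
    (hz0 : z ≠ 0) (hzb0 : zb ≠ 0) (hh : h ≠ 0) (hq : q ≠ 0) (hs : s ≠ 0) :
    -(((r ^ 2 + a ^ 2) * (-Complex.I * ω) + a * E * (-Complex.I * l)) / (z * zb * h)
        * (e / zb * (Xp * Ym)))
      - h / (z * zb) * (e / zb * ((X' - (D / (4 * h ^ 2) + 1 / (2 * zb ^ 2)) * Xp) * Ym))
      + q / (z * zb) * (e / zb * (Xm * (Y' - Complex.I * a * s / (2 * zb ^ 2) * Yp)))
      + Complex.I * ((-(a * s) * (-Complex.I * ω) - E / s * (-Complex.I * l)) / (z * zb * q)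
        * (e / zb * (Xm * Yp)))
      - (2 * r * h ^ 2 + D * (z * zb) ^ 2) / (4 * h * (z * zb) ^ 3) * (e / zb * (Xp * Ym))
      + ((a ^ 2 * c * s * (q ^ 2 - κ ^ 2 * (z * zb) ^ 2) / (q * (z * zb) ^ 3)
          + q * c / (z * zb * s)) - 2 * a ^ 2 * c * s * q / (z * zb) ^ 3) / 2
        * (e / zb * (Xm * Yp))
      - Complex.I / 4 * (2 * a * c * h / (z * zb) ^ 3) * (e / zb * (Xp * Ym))
      + Complex.I / 4 * (2 * a * r * s * q / (z * zb) ^ 3) * (e / zb * (Xm * Yp))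
      - Complex.I * (-Q * r / (z * zb * h)) * (e / zb * (Xp * Ym))
      + Complex.I * (-P * c / (z * zb * q * s)) * (Complex.I * (e / zb * (Xm * Yp)))
      + Complex.I * lam * (e / z * (Xm * Ym))
    = -(e / (z * zb ^ 2)) *
      ((h * (X' - Complex.I * ((ω * (r ^ 2 + a ^ 2) + Q * r + l * E * a) / h ^ 2) * Xp)
          - Complex.I * lam * r * Xm) * Ym
        - Xm * (a * lam * c * Ym + q * (Y' + (-((ω * a * s + l * E / s - P * (c / s)) / q ^ 2)
          + (c / s - κ ^ 2 * a ^ 2 * s * c / q ^ 2) / 2) * Yp))) := by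
  -- Eliminating r leaves a rational identity modulo I² = -1 and zb² = z² - 2Iac; no relation
  -- between s and c, or between h, q and the other variables, is needed.
  have hr : r = z ^ 2 - Complex.I * a * c := by rw [hz]; ring
  have hI := Complex.I_sq
  generalize Complex.I = I at *
  subst hr
  field_simp
  grind

theorem dirac_component_one (hz : z ^ 2 = r + Complex.I * a * c)
    (hzb : zb ^ 2 = r - Complex.I * a * c)
    (hz0 : z ≠ 0) (hzb0 : zb ≠ 0) (hh : h ≠ 0) (hq : q ≠ 0) (hs : s ≠ 0) :
    -(((r ^ 2 + a ^ 2) * (-Complex.I * ω) + a * E * (-Complex.I * l)) / (z * zb * h)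
        * (e / zb * (Xm * Yp)))
      + h / (z * zb) * (e / zb * ((X' - (D / (4 * h ^ 2) + 1 / (2 * zb ^ 2)) * Xm) * Yp))
      + q / (z * zb) * (e / zb * (Xp * (Y' - Complex.I * a * s / (2 * zb ^ 2) * Ym)))
      - Complex.I * ((-(a * s) * (-Complex.I * ω) - E / s * (-Complex.I * l)) / (z * zb * q)
        * (e / zb * (Xp * Ym)))
      + (2 * r * h ^ 2 + D * (z * zb) ^ 2) / (4 * h * (z * zb) ^ 3) * (e / zb * (Xm * Yp))
      + ((a ^ 2 * c * s * (q ^ 2 - κ ^ 2 * (z * zb) ^ 2) / (q * (z * zb) ^ 3)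
          + q * c / (z * zb * s)) - 2 * a ^ 2 * c * s * q / (z * zb) ^ 3) / 2
        * (e / zb * (Xp * Ym))
      + Complex.I / 4 * (2 * a * c * h / (z * zb) ^ 3) * (e / zb * (Xm * Yp))
      + Complex.I / 4 * (2 * a * r * s * q / (z * zb) ^ 3) * (e / zb * (Xp * Ym))
      - Complex.I * (-Q * r / (z * zb * h)) * (e / zb * (Xm * Yp))
      - Complex.I * (-P * c / (z * zb * q * s)) * (Complex.I * (e / zb * (Xp * Ym)))
      + Complex.I * lam * (e / z * (Xp * Yp))
    = e / (z * zb ^ 2) *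
      ((h * (X' + Complex.I * ((ω * (r ^ 2 + a ^ 2) + Q * r + l * E * a) / h ^ 2) * Xm)
          + Complex.I * lam * r * Xp) * Yp
        - Xp * (-(a * lam * c * Yp) - q * (Y' + ((ω * a * s + l * E / s - P * (c / s)) / q ^ 2
          + (c / s - κ ^ 2 * a ^ 2 * s * c / q ^ 2) / 2) * Ym))) := by
  have hr : r = z ^ 2 - Complex.I * a * c := by rw [hz]; ring
  have hI := Complex.I_sq
  generalize Complex.I = I at *
  subst hr
  field_simp
  grind

theorem dirac_component_two (hz : z ^ 2 = r + Complex.I * a * c)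
    (hzb : zb ^ 2 = r - Complex.I * a * c)
    (hz0 : z ≠ 0) (hzb0 : zb ≠ 0) (hh : h ≠ 0) (hq : q ≠ 0) (hs : s ≠ 0) :
    -(((r ^ 2 + a ^ 2) * (-Complex.I * ω) + a * E * (-Complex.I * l)) / (z * zb * h)
        * (e / z * (Xm * Ym)))
      + h / (z * zb) * (e / z * ((X' - (D / (4 * h ^ 2) + 1 / (2 * z ^ 2)) * Xm) * Ym))
      - q / (z * zb) * (e / z * (Xp * (Y' + Complex.I * a * s / (2 * z ^ 2) * Yp)))
      - Complex.I * ((-(a * s) * (-Complex.I * ω) - E / s * (-Complex.I * l)) / (z * zb * q)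
        * (e / z * (Xp * Yp)))
      + (2 * r * h ^ 2 + D * (z * zb) ^ 2) / (4 * h * (z * zb) ^ 3) * (e / z * (Xm * Ym))
      - ((a ^ 2 * c * s * (q ^ 2 - κ ^ 2 * (z * zb) ^ 2) / (q * (z * zb) ^ 3)
          + q * c / (z * zb * s)) - 2 * a ^ 2 * c * s * q / (z * zb) ^ 3) / 2
        * (e / z * (Xp * Yp))
      - Complex.I / 4 * (2 * a * c * h / (z * zb) ^ 3) * (e / z * (Xm * Ym))
      + Complex.I / 4 * (2 * a * r * s * q / (z * zb) ^ 3) * (e / z * (Xp * Yp))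
      - Complex.I * (-Q * r / (z * zb * h)) * (e / z * (Xm * Ym))
      - Complex.I * (-P * c / (z * zb * q * s)) * (Complex.I * (e / z * (Xp * Yp)))
      + Complex.I * lam * (e / zb * (Xp * Ym))
    = e / (z ^ 2 * zb) *
      ((h * (X' + Complex.I * ((ω * (r ^ 2 + a ^ 2) + Q * r + l * E * a) / h ^ 2) * Xm)
          + Complex.I * lam * r * Xp) * Ym
        - Xp * (a * lam * c * Ym + q * (Y' + (-((ω * a * s + l * E / s - P * (c / s)) / q ^ 2)
          + (c / s - κ ^ 2 * a ^ 2 * s * c / q ^ 2) / 2) * Yp))) := by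
  have hr : r = z ^ 2 - Complex.I * a * c := by rw [hz]; ring
  have hI := Complex.I_sq
  generalize Complex.I = I at *
  subst hr
  field_simp
  grind

theorem dirac_component_three (hz : z ^ 2 = r + Complex.I * a * c)
    (hzb : zb ^ 2 = r - Complex.I * a * c)
    (hz0 : z ≠ 0) (hzb0 : zb ≠ 0) (hh : h ≠ 0) (hq : q ≠ 0) (hs : s ≠ 0) :
    -(((r ^ 2 + a ^ 2) * (-Complex.I * ω) + a * E * (-Complex.I * l)) / (z * zb * h)
        * (e / z * (Xp * Yp)))
      - h / (z * zb) * (e / z * ((X' - (D / (4 * h ^ 2) + 1 / (2 * z ^ 2)) * Xp) * Yp))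
      - q / (z * zb) * (e / z * (Xm * (Y' + Complex.I * a * s / (2 * z ^ 2) * Ym)))
      + Complex.I * ((-(a * s) * (-Complex.I * ω) - E / s * (-Complex.I * l)) / (z * zb * q)
        * (e / z * (Xm * Ym)))
      - (2 * r * h ^ 2 + D * (z * zb) ^ 2) / (4 * h * (z * zb) ^ 3) * (e / z * (Xp * Yp))
      - ((a ^ 2 * c * s * (q ^ 2 - κ ^ 2 * (z * zb) ^ 2) / (q * (z * zb) ^ 3)
          + q * c / (z * zb * s)) - 2 * a ^ 2 * c * s * q / (z * zb) ^ 3) / 2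
        * (e / z * (Xm * Ym))
      + Complex.I / 4 * (2 * a * c * h / (z * zb) ^ 3) * (e / z * (Xp * Yp))
      + Complex.I / 4 * (2 * a * r * s * q / (z * zb) ^ 3) * (e / z * (Xm * Ym))
      - Complex.I * (-Q * r / (z * zb * h)) * (e / z * (Xp * Yp))
      + Complex.I * (-P * c / (z * zb * q * s)) * (Complex.I * (e / z * (Xm * Ym)))
      + Complex.I * lam * (e / zb * (Xm * Yp))
    = -(e / (z ^ 2 * zb)) *
      ((h * (X' - Complex.I * ((ω * (r ^ 2 + a ^ 2) + Q * r + l * E * a) / h ^ 2) * Xp)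
          - Complex.I * lam * r * Xm) * Yp
        - Xm * (-(a * lam * c * Yp) - q * (Y' + ((ω * a * s + l * E / s - P * (c / s)) / q ^ 2
          + (c / s - κ ^ 2 * a ^ 2 * s * c / q ^ 2) / 2) * Ym))) := by
  have hr : r = z ^ 2 - Complex.I * a * c := by rw [hz]; ring
  have hI := Complex.I_sq
  generalize Complex.I = I at *
  subst hr
  field_simp
  grind

end algebra

theorem DiracChart.extDeriv_swap_eq {θ : Pt → Pt} {x v w : Pt} {c : ℝ}
    (h : extDeriv θ x v w = c) : extDeriv θ x w v = -c := by
  rw [extDeriv_swap, h]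

theorem DiracChart.extDeriv_swap_eq_zero {θ : Pt → Pt} {x v w : Pt}
    (h : extDeriv θ x v w = 0) : extDeriv θ x w v = 0 := by
  rw [extDeriv_swap, h, neg_zero]

/-! ### The Dirac operator and the potential in the Kerr–Newman–de Sitter frame -/

namespace KNdS

variable {M : KNdS} {rm rp ω lam : ℝ} {k : ℤ} {Xp Xm Yp Ym : ℝ → ℂ} {Ψ : Pt → Fin 4 → ℂ}

theorem dirac_coframe {x : Pt} (hr : 0 < x 1) (hΔ : 0 < M.Δr (x 1))
    (hs : 0 < Real.sin (x 2)) :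
    dirac M.coframe M.frame Ψ x
      = (∑ α, gam α *ᵥ ∑ μ, ((M.frame α x μ : ℝ) : ℂ) • pd μ Ψ x)
        + (((2 * x 1 * √(M.Δr (x 1)) ^ 2 + M.Δr' (x 1) * √(M.U (x 1) (x 2)) ^ 2)
          / (4 * √(M.Δr (x 1)) * √(M.U (x 1) (x 2)) ^ 3) : ℝ) : ℂ) • (gam 1 *ᵥ Ψ x)
        + (((M.a ^ 2 * Real.cos (x 2) * Real.sin (x 2)
              * (√(M.Δθ (x 2)) ^ 2 - M.κ ^ 2 * √(M.U (x 1) (x 2)) ^ 2)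
              / (√(M.Δθ (x 2)) * √(M.U (x 1) (x 2)) ^ 3)
            + √(M.Δθ (x 2)) * Real.cos (x 2) / (√(M.U (x 1) (x 2)) * Real.sin (x 2))
            - 2 * M.a ^ 2 * Real.cos (x 2) * Real.sin (x 2) * √(M.Δθ (x 2))
              / √(M.U (x 1) (x 2)) ^ 3) / 2 : ℝ) : ℂ) • (gam 2 *ᵥ Ψ x)
        + (((2 * M.a * Real.cos (x 2) * √(M.Δr (x 1)) / √(M.U (x 1) (x 2)) ^ 3 / 4 : ℝ) : ℂ)
            • (gam 0 *ᵥ (gam 2 *ᵥ (gam 3 *ᵥ Ψ x)))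
          - ((2 * M.a * x 1 * Real.sin (x 2) * √(M.Δθ (x 2)) / √(M.U (x 1) (x 2)) ^ 3 / 4 : ℝ) : ℂ)
            • (gam 0 *ᵥ (gam 1 *ᵥ (gam 3 *ᵥ Ψ x)))) := by
  obtain ⟨c001, c002, c003, c012, c013, c023⟩ := structure_zero hr hΔ hs
  obtain ⟨c101, c102, c103, c112, c113, c123⟩ := structure_one hr hΔ
  obtain ⟨c201, c202, c203, c212, c213, c223⟩ := structure_two hr hΔ
  obtain ⟨c301, c302, c303, c312, c313, c323⟩ := structure_three hr hΔ hs
  have h1 := Real.sqrt_pos.2 hΔ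
  have h2 := Real.sqrt_pos.2 (M.U_pos hr (x 2))
  rw [dirac_eq_of_structure]
  rotate_left
  · intro α β γ
    fin_cases α
    · fin_cases β <;> fin_cases γ
      exacts [extDeriv_self _ _ _, c001, c002, c003,
        extDeriv_swap_eq c001, extDeriv_self _ _ _, c012, c013,
        extDeriv_swap_eq c002,
        extDeriv_swap_eq_zero c012, extDeriv_self _ _ _, c023,
        extDeriv_swap_eq_zero c003,
        extDeriv_swap_eq_zero c013,
        extDeriv_swap_eq c023, extDeriv_self _ _ _]
    · fin_cases β <;> fin_cases γ
      exacts [extDeriv_self _ _ _, c101, c102, c103,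
        extDeriv_swap_eq_zero c101, extDeriv_self _ _ _, c112, c113,
        extDeriv_swap_eq_zero c102,
        extDeriv_swap_eq c112, extDeriv_self _ _ _, c123,
        extDeriv_swap_eq_zero c103,
        extDeriv_swap_eq_zero c113,
        extDeriv_swap_eq_zero c123, extDeriv_self _ _ _]
    · fin_cases β <;> fin_cases γ
      exacts [extDeriv_self _ _ _, c201, c202, c203,
        extDeriv_swap_eq_zero c201, extDeriv_self _ _ _, c212, c213,
        extDeriv_swap_eq_zero c202,
        extDeriv_swap_eq c212, extDeriv_self _ _ _, c223,
        extDeriv_swap_eq_zero c203,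
        extDeriv_swap_eq_zero c213,
        extDeriv_swap_eq_zero c223, extDeriv_self _ _ _]
    · fin_cases β <;> fin_cases γ
      exacts [extDeriv_self _ _ _, c301, c302, c303,
        extDeriv_swap_eq c301, extDeriv_self _ _ _, c312, c313,
        extDeriv_swap_eq_zero c302,
        extDeriv_swap_eq_zero c312, extDeriv_self _ _ _, c323,
        extDeriv_swap_eq_zero c303,
        extDeriv_swap_eq c313,
        extDeriv_swap_eq c323, extDeriv_self _ _ _]
  generalize √(M.U (x 1) (x 2)) = u at *
  generalize √(M.Δr (x 1)) = h at *
  have hu : (u : ℂ) ≠ 0 := Complex.ofReal_ne_zero.2 h2.ne'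
  have hh : (h : ℂ) ≠ 0 := Complex.ofReal_ne_zero.2 h1.ne'
  congr 1
  · congr 1
    · congr 2
      push_cast
      field_simp
      ring
    · congr 1
      push_cast
      ring
  · congr 1 <;> congr 1 <;> push_cast <;> ring

/-- The two one-forms composing A are multiples of e^0 and e^3. By duality Q appears only in A(e_0),
P only in A(e_3), and the other two components vanish. -/
theorem pair_potential_zero {x : Pt} (hr : 0 < x 1) :
    pair (M.potential x) (M.frame 0 x)
      = -M.Q * x 1 / (√(M.U (x 1) (x 2)) * √(M.Δr (x 1))) := by
  rw [frame_zero hr]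
  have h4 : M.U (x 1) (x 2) = x 1 ^ 2 + M.a ^ 2 * Real.cos (x 2) ^ 2 := rfl
  have h5 := Real.sin_sq_add_cos_sq (x 2)
  have hU := M.U_pos hr (x 2)
  have hE := M.E_pos
  simp only [pair, potential, Fin.sum_univ_four, Pi.sub_apply, Pi.smul_apply, smul_eq_mul,
    Matrix.cons_val]
  -- If the denominator is zero, both sides are zero by the convention x/0 = 0.
  rcases eq_or_ne (√(M.U (x 1) (x 2)) * √(M.Δr (x 1))) 0 with h0 | h0
  · simp [h0]
  generalize √(M.U (x 1) (x 2)) * √(M.Δr (x 1)) = u at *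
  generalize M.U (x 1) (x 2) = U at *
  field_simp
  grind

theorem pair_potential_one {x : Pt} (hΔ : 0 < M.Δr (x 1)) :
    pair (M.potential x) (M.frame 1 x) = 0 := by
  rw [frame_one hΔ]
  simp [pair, potential, Fin.sum_univ_four]

theorem pair_potential_two {x : Pt} : pair (M.potential x) (M.frame 2 x) = 0 := by
  rw [frame_two]
  simp [pair, potential, Fin.sum_univ_four]

theorem pair_potential_three {x : Pt} (hr : 0 < x 1) (hs : 0 < Real.sin (x 2)) :
    pair (M.potential x) (M.frame 3 x)
      = -M.P * Real.cos (x 2) / (√(M.U (x 1) (x 2)) * √(M.Δθ (x 2)) * Real.sin (x 2)) := by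
  rw [frame_three hr]
  have h4 : M.U (x 1) (x 2) = x 1 ^ 2 + M.a ^ 2 * Real.cos (x 2) ^ 2 := rfl
  have h5 := Real.sin_sq_add_cos_sq (x 2)
  have hU := M.U_pos hr (x 2)
  have hE := M.E_pos
  simp only [pair, potential, Fin.sum_univ_four, Pi.sub_apply, Pi.smul_apply, smul_eq_mul,
    Matrix.cons_val]
  rcases eq_or_ne (√(M.U (x 1) (x 2)) * √(M.Δθ (x 2))) 0 with h0 | h0
  · simp [h0]
  generalize √(M.U (x 1) (x 2)) * √(M.Δθ (x 2)) = u at *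
  generalize M.U (x 1) (x 2) = U at *
  field_simp
  grind

end KNdS

/-! ### Separation of the Dirac equation -/

namespace KNdS

variable {M : KNdS} {rm rp ω lam : ℝ} {k : ℤ} {Xp Xm Yp Ym : ℝ → ℂ} {Ψ : Pt → Fin 4 → ℂ}

/-- The left-hand side of the first radial equation. -/
noncomputable def radialPlus (M : KNdS) (ω lam : ℝ) (k : ℤ) (Xp Xm : ℝ → ℂ) (r : ℝ) : ℂ :=
  (√(M.Δr r) : ℂ) * M.Dr 1 ω k Xp r - Complex.I * lam * r * Xm r

/-- The left-hand side of the second radial equation. -/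
noncomputable def radialMinus (M : KNdS) (ω lam : ℝ) (k : ℤ) (Xp Xm : ℝ → ℂ) (r : ℝ) : ℂ :=
  (√(M.Δr r) : ℂ) * M.Dr (-1) ω k Xm r + Complex.I * lam * r * Xp r

/-- The left-hand side of the first angular equation. -/
noncomputable def angularPlus (M : KNdS) (ω lam : ℝ) (k : ℤ) (Yp Ym : ℝ → ℂ) (θ : ℝ) : ℂ :=
  M.a * lam * Real.cos θ * Ym θ + (√(M.Δθ θ) : ℂ) * M.Lθ 1 ω k Yp θ

/-- The left-hand side of the second angular equation. -/
noncomputable def angularMinus (M : KNdS) (ω lam : ℝ) (k : ℤ) (Yp Ym : ℝ → ℂ) (θ : ℝ) : ℂ :=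
  -(M.a * lam * Real.cos θ * Yp θ) - (√(M.Δθ θ) : ℂ) * M.Lθ (-1) ω k Ym θ

theorem separated_products (h : M.IsExtreme rm rp) (hsol : M.IsDiracSolution rm rp lam Ψ)
    (hsep : M.IsSeparated rm rp ω k Xp Xm Yp Ym Ψ) {r θ : ℝ} (hr : r ∈ Set.Ioo rm rp)
    (hθ : θ ∈ Set.Ioo 0 Real.pi) (hXp : DifferentiableAt ℝ Xp r) (hXm : DifferentiableAt ℝ Xm r)
    (hYp : DifferentiableAt ℝ Yp θ) (hYm : DifferentiableAt ℝ Ym θ) :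
    M.radialPlus ω lam k Xp Xm r * Ym θ = Xm r * M.angularPlus ω lam k Yp Ym θ ∧
      M.radialMinus ω lam k Xp Xm r * Yp θ = Xp r * M.angularMinus ω lam k Yp Ym θ ∧
      M.radialMinus ω lam k Xp Xm r * Ym θ = Xp r * M.angularPlus ω lam k Yp Ym θ ∧
      M.radialPlus ω lam k Xp Xm r * Yp θ = Xm r * M.angularMinus ω lam k Yp Ym θ := by
  -- The phase is a common nonzero factor, so the equation at t = φ = 0 carries all the information.
  have hx : ![0, r, θ, 0] ∈ exterior rm rp := ⟨hr, hθ⟩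
  have hr0 := h.pos hr
  have hΔ := h.Δr_pos hr
  have hs := Real.sin_pos_of_pos_of_lt_pi hθ.1 hθ.2
  have hX : ∀ i, DifferentiableAt ℝ (radialFactor Xp Xm i) r := by
    intro i
    fin_cases i
    exacts [hXm, hXp, hXp, hXm]
  have hY : ∀ i, DifferentiableAt ℝ (angularFactor Yp Ym i) θ := by
    intro i
    fin_cases i
    exacts [hYm, hYp, hYm, hYp]
  have key := hsol.eq _ hx
  have hΨ := hsep.apply_eq h hx
  have p0 := hsep.pd_zero h hsol.differentiableOn hx
  have p1 := fun i => hsep.pd_one h hsol.differentiableOn hx i (hX i)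
  have p2 := fun i => hsep.pd_two h hsol.differentiableOn hx i (hY i)
  have p3 := hsep.pd_three h hsol.differentiableOn hx
  have hz0 := rootFactor_ne_zero (b := M.a) (θ := θ) hr0
  have hzb0 := rootFactor_ne_zero (b := -M.a) (θ := θ) hr0
  have hz := rootFactor_sq (b := M.a) (r := r) (θ := θ)
  have hzb := rootFactor_sq (b := -M.a) (r := r) (θ := θ)
  have hu : ((√(M.U r θ) : ℝ) : ℂ) = rootFactor M.a r θ * rootFactor (-M.a) r θ :=
    (rootFactor_mul_rootFactor_neg hr0).symm
  have he : phase ω k 0 0 / M.quarter r ≠ 0 := div_ne_zero (phase_ne_zero _ _) (quarter_ne_zero hΔ)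
  have hh : ((√(M.Δr r) : ℝ) : ℂ) ≠ 0 := Complex.ofReal_ne_zero.2 (Real.sqrt_pos.2 hΔ).ne'
  have hq : ((√(M.Δθ θ) : ℝ) : ℂ) ≠ 0 :=
    Complex.ofReal_ne_zero.2 (Real.sqrt_pos.2 (M.Δθ_pos θ)).ne'
  have hs' : ((Real.sin θ : ℝ) : ℂ) ≠ 0 := Complex.ofReal_ne_zero.2 hs.ne'
  have hh2 : (M.Δr r : ℂ) = ((√(M.Δr r) : ℝ) : ℂ) ^ 2 := by
    rw [← Complex.ofReal_pow, Real.sq_sqrt hΔ.le]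
  have hq2 : (M.Δθ θ : ℂ) = ((√(M.Δθ θ) : ℝ) : ℂ) ^ 2 := by
    rw [← Complex.ofReal_pow, Real.sq_sqrt (M.Δθ_pos θ).le]
  rw [DiracEqAt, dirac_coframe (x := ![0, r, θ, 0]) hr0 hΔ hs] at key
  simp only [Fin.sum_univ_four, pair_potential_zero (M := M) (x := ![0, r, θ, 0]) hr0,
    pair_potential_one (M := M) (x := ![0, r, θ, 0]) hΔ, pair_potential_two,
    pair_potential_three (M := M) (x := ![0, r, θ, 0]) hr0 hs] at key
  simp only [frame_zero (M := M) (x := ![0, r, θ, 0]) hr0,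
    frame_one (M := M) (x := ![0, r, θ, 0]) hΔ, frame_two,
    frame_three (M := M) (x := ![0, r, θ, 0]) hr0,
    Matrix.cons_val, gam_zero_mulVec, gam_one_mulVec, gam_two_mulVec, gam_three_mulVec] at key
  have k0 := congrFun key 0
  have k1 := congrFun key 1
  have k2 := congrFun key 2
  have k3 := congrFun key 3
  clear key
  simp only [Pi.add_apply, Pi.sub_apply, Pi.smul_apply, Pi.zero_apply, smul_eq_mul,
    Matrix.cons_val, p0, p1, p2, p3, hΨ, separatedSpinor, Complex.ofReal_div, Complex.ofReal_mul,
    Complex.ofReal_add, Complex.ofReal_sub, Complex.ofReal_neg, Complex.ofReal_pow,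
    Complex.ofReal_zero, Complex.ofReal_ofNat, hu, radialFactor, angularFactor,
    signedRotation] at k0 k1 k2 k3
  simp only [radialPlus, radialMinus, angularPlus, angularMinus, Dr, Lθ, Real.cot_eq_cos_div_sin,
    Complex.ofReal_div, Complex.ofReal_mul, Complex.ofReal_add, Complex.ofReal_sub,
    Complex.ofReal_neg, Complex.ofReal_pow, Complex.ofReal_one, Complex.ofReal_ofNat,
    Complex.ofReal_intCast, hh2, hq2]
  clear p0 p1 p2 p3 hΨ
  have hzb' : rootFactor (-M.a) r θ ^ 2 = r - Complex.I * M.a * Real.cos θ := by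
    rw [hzb]; push_cast; ring
  have n1 : phase ω k 0 0 / M.quarter r / (rootFactor M.a r θ * rootFactor (-M.a) r θ ^ 2) ≠ 0 :=
    div_ne_zero he (mul_ne_zero hz0 (pow_ne_zero 2 hzb0))
  have n2 : phase ω k 0 0 / M.quarter r / (rootFactor M.a r θ ^ 2 * rootFactor (-M.a) r θ) ≠ 0 :=
    div_ne_zero he (mul_ne_zero (pow_ne_zero 2 hz0) hzb0)
  refine ⟨?_, ?_, ?_, ?_⟩ <;> rw [← sub_eq_zero]
  · refine (mul_eq_zero.1 ?_).resolve_left n1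
    rw [← neg_eq_zero]
    have z0 := dirac_component_zero (e := phase ω k 0 0 / M.quarter r) (lam := lam) (Q := M.Q)
      (P := M.P) (ω := ω) (l := k + 1 / 2) (E := M.E) (κ := M.κ) (D := M.Δr' r) (Xp := Xp r)
      (Xm := Xm r) (Yp := Yp θ) (Ym := Ym θ) (X' := deriv Xp r) (Y' := deriv Yp θ)
      hz hzb' hz0 hzb0 hh hq hs'
    linear_combination k0 - z0
  · refine (mul_eq_zero.1 ?_).resolve_left n1
    have z1 := dirac_component_one (e := phase ω k 0 0 / M.quarter r) (lam := lam) (Q := M.Q)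
      (P := M.P) (ω := ω) (l := k + 1 / 2) (E := M.E) (κ := M.κ) (D := M.Δr' r) (Xp := Xp r)
      (Xm := Xm r) (Yp := Yp θ) (Ym := Ym θ) (X' := deriv Xm r) (Y' := deriv Ym θ)
      hz hzb' hz0 hzb0 hh hq hs'
    linear_combination k1 - z1
  · refine (mul_eq_zero.1 ?_).resolve_left n2
    have z2 := dirac_component_two (e := phase ω k 0 0 / M.quarter r) (lam := lam) (Q := M.Q)
      (P := M.P) (ω := ω) (l := k + 1 / 2) (E := M.E) (κ := M.κ) (D := M.Δr' r) (Xp := Xp r)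
      (Xm := Xm r) (Yp := Yp θ) (Ym := Ym θ) (X' := deriv Xm r) (Y' := deriv Yp θ)
      hz hzb' hz0 hzb0 hh hq hs'
    linear_combination k2 - z2
  · refine (mul_eq_zero.1 ?_).resolve_left n2
    rw [← neg_eq_zero]
    have z3 := dirac_component_three (e := phase ω k 0 0 / M.quarter r) (lam := lam) (Q := M.Q)
      (P := M.P) (ω := ω) (l := k + 1 / 2) (E := M.E) (κ := M.κ) (D := M.Δr' r) (Xp := Xp r)
      (Xm := Xm r) (Yp := Yp θ) (Ym := Ym θ) (X' := deriv Xp r) (Y' := deriv Ym θ)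
      hz hzb' hz0 hzb0 hh hq hs'
    linear_combination k3 - z3

end KNdS

/-! ### Existence and uniqueness of the separation constant -/

namespace KNdS

variable {M : KNdS} {rm rp ω lam : ℝ} {k : ℤ} {Xp Xm Yp Ym : ℝ → ℂ} {Ψ : Pt → Fin 4 → ℂ}

theorem IsSeparated.exists_ne_zero (hsep : M.IsSeparated rm rp ω k Xp Xm Yp Ym Ψ)
    (h : M.IsExtreme rm rp) (hne : ∃ x ∈ exterior rm rp, Ψ x ≠ 0) :
    ∃ r ∈ Set.Ioo rm rp, ∃ θ ∈ Set.Ioo 0 Real.pi,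
      (Xp r ≠ 0 ∨ Xm r ≠ 0) ∧ (Yp θ ≠ 0 ∨ Ym θ ≠ 0) := by
  obtain ⟨x, hx, hΨ⟩ := hne
  refine ⟨x 1, hx.1, x 2, hx.2, ?_⟩
  by_contra hcon
  refine hΨ (funext fun i => ?_)
  rw [hsep.apply_eq h hx, separatedSpinor]
  have : radialFactor Xp Xm i (x 1) * angularFactor Yp Ym i (x 2) = 0 := by
    fin_cases i <;> simp [radialFactor, angularFactor] <;> tauto
  simp [this]

theorem IsSeparated.differentiableAt_Xp_Xm (hsep : M.IsSeparated rm rp ω k Xp Xm Yp Ym Ψ)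
    (h : M.IsExtreme rm rp) (hd : DifferentiableOn ℝ Ψ (exterior rm rp)) {r θ : ℝ}
    (hr : r ∈ Set.Ioo rm rp) (hθ : θ ∈ Set.Ioo 0 Real.pi) (hY : Yp θ ≠ 0 ∨ Ym θ ≠ 0) :
    DifferentiableAt ℝ Xp r ∧ DifferentiableAt ℝ Xm r := by
  rcases hY with hY | hY
  · exact ⟨hsep.differentiableAt_radial h hd hr hθ 1 hY,
      hsep.differentiableAt_radial h hd hr hθ 3 hY⟩
  · exact ⟨hsep.differentiableAt_radial h hd hr hθ 2 hY,
      hsep.differentiableAt_radial h hd hr hθ 0 hY⟩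

theorem IsSeparated.differentiableAt_Yp_Ym (hsep : M.IsSeparated rm rp ω k Xp Xm Yp Ym Ψ)
    (h : M.IsExtreme rm rp) (hd : DifferentiableOn ℝ Ψ (exterior rm rp)) {r θ : ℝ}
    (hr : r ∈ Set.Ioo rm rp) (hθ : θ ∈ Set.Ioo 0 Real.pi) (hX : Xp r ≠ 0 ∨ Xm r ≠ 0) :
    DifferentiableAt ℝ Yp θ ∧ DifferentiableAt ℝ Ym θ := by
  rcases hX with hX | hX
  · exact ⟨hsep.differentiableAt_angular h hd hr hθ 1 hX,
      hsep.differentiableAt_angular h hd hr hθ 2 hX⟩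
  · exact ⟨hsep.differentiableAt_angular h hd hr hθ 3 hX,
      hsep.differentiableAt_angular h hd hr hθ 0 hX⟩

/-- At a fixed θ₀ with (Y_+, Y_-) ≠ 0, the quotient of an angular expression by its Y is a number
that serves for all r in both radial equations. Reading the product identities at a fixed r₀ with
(X_+, X_-) ≠ 0 returns the same number for all θ. -/
theorem exists_isSeparationConstant (h : M.IsExtreme rm rp) (hsol : M.IsDiracSolution rm rp lam Ψ)
    (hsep : M.IsSeparated rm rp ω k Xp Xm Yp Ym Ψ) (hne : ∃ x ∈ exterior rm rp, Ψ x ≠ 0) :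
    ∃ ε, M.IsSeparationConstant rm rp ω lam k Xp Xm Yp Ym ε := by
  obtain ⟨r₀, hr₀, θ₀, hθ₀, hX, hY⟩ := hsep.exists_ne_zero h hne
  have dX := fun r hr => hsep.differentiableAt_Xp_Xm h hsol.differentiableOn (r := r) hr hθ₀ hY
  have dY := fun θ hθ => hsep.differentiableAt_Yp_Ym h hsol.differentiableOn (θ := θ) hr₀ hθ hX
  have key := fun r θ (hr : r ∈ Set.Ioo rm rp) (hθ : θ ∈ Set.Ioo 0 Real.pi) =>
    separated_products h hsol hsep hr hθ (dX r hr).1 (dX r hr).2 (dY θ hθ).1 (dY θ hθ).2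
  obtain ⟨ε, hε⟩ : ∃ ε, ∀ r ∈ Set.Ioo rm rp, M.radialPlus ω lam k Xp Xm r = ε * Xm r ∧
      M.radialMinus ω lam k Xp Xm r = ε * Xp r := by
    rcases hY with hY | hY
    · refine ⟨M.angularMinus ω lam k Yp Ym θ₀ / Yp θ₀, fun r hr => ?_⟩
      obtain ⟨-, e2, -, e4⟩ := key r θ₀ hr hθ₀
      constructor <;> field_simp
      · rw [e4]; ring
      · rw [e2]; ring
    · refine ⟨M.angularPlus ω lam k Yp Ym θ₀ / Ym θ₀, fun r hr => ?_⟩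
      obtain ⟨e1, -, e3, -⟩ := key r θ₀ hr hθ₀
      constructor <;> field_simp
      · rw [e1]; ring
      · rw [e3]; ring
  have hang : ∀ θ ∈ Set.Ioo 0 Real.pi, M.angularPlus ω lam k Yp Ym θ = ε * Ym θ ∧
      M.angularMinus ω lam k Yp Ym θ = ε * Yp θ := by
    intro θ hθ
    obtain ⟨e1, e2, e3, e4⟩ := key r₀ θ hr₀ hθ
    rw [(hε r₀ hr₀).1] at e1 e4
    rw [(hε r₀ hr₀).2] at e2 e3
    rcases hX with hX | hX
    · exact ⟨mul_left_cancel₀ hX (by rw [← e3]; ring), mul_left_cancel₀ hX (by rw [← e2]; ring)⟩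
    · exact ⟨mul_left_cancel₀ hX (by rw [← e1]; ring), mul_left_cancel₀ hX (by rw [← e4]; ring)⟩
  exact ⟨ε, fun r hr => (dX r hr).1, fun r hr => (dX r hr).2, fun θ hθ => (dY θ hθ).1,
    fun θ hθ => (dY θ hθ).2, fun r hr => (hε r hr).1, fun r hr => (hε r hr).2,
    fun θ hθ => (hang θ hθ).1, fun θ hθ => (hang θ hθ).2⟩

theorem IsSeparationConstant.unique {ε ε' : ℂ}
    (hε : M.IsSeparationConstant rm rp ω lam k Xp Xm Yp Ym ε)
    (hε' : M.IsSeparationConstant rm rp ω lam k Xp Xm Yp Ym ε') {r : ℝ} (hr : r ∈ Set.Ioo rm rp)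
    (hX : Xp r ≠ 0 ∨ Xm r ≠ 0) : ε = ε' := by
  rcases hX with hX | hX
  · exact mul_right_cancel₀ hX ((hε.radial_minus r hr).symm.trans (hε'.radial_minus r hr))
  · exact mul_right_cancel₀ hX ((hε.radial_plus r hr).symm.trans (hε'.radial_plus r hr))

end KNdS

/-! ### Reality of the separation constant -/

theorem norm_rootFactor_le {b r θ : ℝ} : ‖rootFactor b r θ‖ ≤ 1 + √(r ^ 2 + b ^ 2) := by
  have h1 := norm_rootFactor_sq (b := b) (r := r) (θ := θ)
  have h2 : √(r ^ 2 + b ^ 2 * Real.cos θ ^ 2) ≤ √(r ^ 2 + b ^ 2) :=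
    Real.sqrt_le_sqrt (by nlinarith [sq_nonneg b, Real.cos_sq_le_one θ])
  nlinarith [sq_nonneg (‖rootFactor b r θ‖ - 1), Real.sqrt_nonneg (r ^ 2 + b ^ 2)]

/-- A monotone function on `(0, π)` that is dominated by a multiple of `sin` vanishes. -/
theorem eq_zero_of_monotoneOn_of_abs_le_sin {F : ℝ → ℝ} {K : ℝ}
    (hF : MonotoneOn F (Set.Ioo 0 Real.pi)) (hK : ∀ x ∈ Set.Ioo 0 Real.pi, |F x| ≤ K * Real.sin x)
    {x : ℝ} (hx : x ∈ Set.Ioo 0 Real.pi) : F x = 0 := by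
  have hc : Continuous fun y => K * Real.sin y := by fun_prop
  apply le_antisymm
  -- By monotonicity F x ≤ F y ≤ K sin y for x < y < π; letting y → π gives F x ≤ 0. The pole 0
  -- gives the other inequality.
  · have h1 : Filter.Tendsto (fun y => K * Real.sin y) (nhdsWithin Real.pi (Set.Iio Real.pi))
        (nhds 0) := by
      simpa using (hc.tendsto Real.pi).mono_left nhdsWithin_le_nhds
    refine ge_of_tendsto h1 ?_
    filter_upwards [Ioo_mem_nhdsLT hx.2] with y hy
    have hy' : y ∈ Set.Ioo 0 Real.pi := ⟨hx.1.trans hy.1, hy.2⟩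
    exact (hF hx hy' hy.1.le).trans ((le_abs_self _).trans (hK y hy'))
  · have h1 : Filter.Tendsto (fun y => -(K * Real.sin y)) (nhdsWithin 0 (Set.Ioi 0))
        (nhds 0) := by
      have hc' : Continuous fun y => -(K * Real.sin y) := by fun_prop
      simpa using (hc'.tendsto 0).mono_left nhdsWithin_le_nhds
    refine le_of_tendsto h1 ?_
    filter_upwards [Ioo_mem_nhdsGT hx.1] with y hy
    have hy' : y ∈ Set.Ioo 0 Real.pi := ⟨hy.1, hy.2.trans hx.2⟩
    exact (neg_le_of_abs_le (hK y hy')).trans (hF hy' hx hy.2.le)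

theorem HasDerivAt.complex_re {f : ℝ → ℂ} {f' : ℂ} {x : ℝ} (h : HasDerivAt f f' x) :
    HasDerivAt (fun y => (f y).re) f'.re x :=
  Complex.reCLM.hasFDerivAt.comp_hasDerivAt x h

theorem HasDerivAt.complex_im {f : ℝ → ℂ} {f' : ℂ} {x : ℝ} (h : HasDerivAt f f' x) :
    HasDerivAt (fun y => (f y).im) f'.im x :=
  Complex.imCLM.hasFDerivAt.comp_hasDerivAt x h

namespace KNdS

variable {M : KNdS} {rm rp ω lam : ℝ} {k : ℤ} {Xp Xm Yp Ym : ℝ → ℂ} {Ψ : Pt → Fin 4 → ℂ}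

/-- At a fixed radius where the radial factor is nonzero, the angular factor is Ψ times functions
bounded uniformly in θ, so the bound at the axis passes to it. -/
theorem bounded_angular (h : M.IsExtreme rm rp) (hsol : M.IsDiracSolution rm rp lam Ψ)
    (hsep : M.IsSeparated rm rp ω k Xp Xm Yp Ym Ψ) {r : ℝ} (hr : r ∈ Set.Ioo rm rp) (i : Fin 4)
    (hX : radialFactor Xp Xm i r ≠ 0) :
    ∃ C, ∀ θ ∈ Set.Ioo 0 Real.pi, ‖angularFactor Yp Ym i θ‖ ≤ C := by
  obtain ⟨C, hC⟩ := hsol.bounded_at_axis 0 0 r hr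
  refine ⟨C * (‖M.quarter r‖ * (1 + √(r ^ 2 + M.signedRotation i ^ 2)))
    / ‖radialFactor Xp Xm i r‖, fun θ hθ => ?_⟩
  have h1 : Ψ ![0, r, θ, 0] i = M.separatedSpinor ω k Xp Xm Yp Ym i 0 r θ 0 :=
    hsep.apply_eq h (x := ![0, r, θ, 0]) ⟨hr, hθ⟩ i
  have h2 := (norm_le_pi_norm _ i).trans (hC θ hθ)
  have n1 := norm_pos_iff.2 (quarter_ne_zero (h.Δr_pos hr))
  have n2 := norm_pos_iff.2 (rootFactor_ne_zero (b := M.signedRotation i) (θ := θ) (h.pos hr))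
  rw [h1, separatedSpinor, norm_div, norm_mul, norm_phase, norm_mul, norm_mul, one_mul,
    div_le_iff₀ (mul_pos n1 n2)] at h2
  have hC0 : 0 ≤ C := (norm_nonneg _).trans (hC θ hθ)
  rw [le_div_iff₀ (norm_pos_iff.2 hX), mul_comm]
  exact h2.trans (by gcongr; exact norm_rootFactor_le)

theorem bounded_Yp_Ym (h : M.IsExtreme rm rp) (hsol : M.IsDiracSolution rm rp lam Ψ)
    (hsep : M.IsSeparated rm rp ω k Xp Xm Yp Ym Ψ) {r : ℝ} (hr : r ∈ Set.Ioo rm rp)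
    (hX : Xp r ≠ 0 ∨ Xm r ≠ 0) :
    ∃ C, ∀ θ ∈ Set.Ioo 0 Real.pi, ‖Yp θ‖ ≤ C ∧ ‖Ym θ‖ ≤ C := by
  have key : ∀ i j : Fin 4, radialFactor Xp Xm i r ≠ 0 → radialFactor Xp Xm j r ≠ 0 →
      angularFactor Yp Ym i = Yp → angularFactor Yp Ym j = Ym →
      ∃ C, ∀ θ ∈ Set.Ioo 0 Real.pi, ‖Yp θ‖ ≤ C ∧ ‖Ym θ‖ ≤ C := by
    intro i j hi hj ei ej
    obtain ⟨C, hC⟩ := bounded_angular h hsol hsep hr i hi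
    obtain ⟨C', hC'⟩ := bounded_angular h hsol hsep hr j hj
    rw [ei] at hC
    rw [ej] at hC'
    exact ⟨max C C', fun θ hθ => ⟨le_max_of_le_left (hC θ hθ), le_max_of_le_right (hC' θ hθ)⟩⟩
  rcases hX with hX | hX
  · exact key 1 2 hX hX rfl rfl
  · exact key 3 0 hX hX rfl rfl

/-- The imaginary part of the angular Wronskian `sin θ √Δ_+(θ) Y_+ conj(Y_-)`. -/
noncomputable def angularFlux (M : KNdS) (Yp Ym : ℝ → ℂ) (θ : ℝ) : ℝ :=
  Real.sin θ * √(M.Δθ θ) * ((Yp θ).im * (Ym θ).re - (Yp θ).re * (Ym θ).im)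

/-- The potential terms of L_{θ+} and L_{θ-} are opposite and cancel in Y_+ conj(Y_-). The real
terms aλ cos θ drop out of the imaginary part, and the weight sin θ √Δ_+(θ) is the integrating
factor for the common zeroth-order term. Only Im ε survives. -/
theorem IsSeparationConstant.hasDerivAt_angularFlux {ε : ℂ}
    (hε : M.IsSeparationConstant rm rp ω lam k Xp Xm Yp Ym ε) {θ : ℝ}
    (hθ : θ ∈ Set.Ioo 0 Real.pi) :
    HasDerivAt (M.angularFlux Yp Ym)
      (ε.im * (Real.sin θ * (Complex.normSq (Yp θ) + Complex.normSq (Ym θ)))) θ := by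
  have hs := Real.sin_pos_of_pos_of_lt_pi hθ.1 hθ.2
  have hΔ := M.Δθ_pos θ
  have hq := Real.sqrt_pos.2 hΔ
  have hq2 := Real.sq_sqrt hΔ.le
  have dp := (hε.diff_Yp θ hθ).hasDerivAt
  have dm := (hε.diff_Ym θ hθ).hasDerivAt
  have dw := (Real.hasDerivAt_sin θ).fun_mul ((M.hasDerivAt_Δθ θ).sqrt hΔ.ne')
  have e1 := hε.angular_plus θ hθ
  have e2 := hε.angular_minus θ hθ
  refine (dw.fun_mul ((dp.complex_im.fun_mul dm.complex_re).fun_sub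
    (dp.complex_re.fun_mul dm.complex_im))).congr_deriv ?_
  simp only [Lθ, Real.cot_eq_cos_div_sin] at e1 e2
  generalize hb : (Real.cos θ / Real.sin θ - M.κ ^ 2 * M.a ^ 2 * Real.sin θ * Real.cos θ
    / M.Δθ θ) / 2 = b at e1 e2
  -- The logarithmic derivative of the weight is 2b, which balances the -b coming from each of Y_+
  -- and Y_-.
  have hw : Real.cos θ * √(M.Δθ θ)
      + Real.sin θ * ((-2 * M.κ ^ 2 * M.a ^ 2 * Real.cos θ * Real.sin θ) / (2 * √(M.Δθ θ)))
      = 2 * b * (Real.sin θ * √(M.Δθ θ)) := by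
    rw [← hb, ← hq2]
    field_simp
    rw [Real.sqrt_sq hq.le]
    ring
  rw [hw]
  generalize (ω * M.a * Real.sin θ + (k + 1 / 2) * M.E / Real.sin θ
    - M.P * (Real.cos θ / Real.sin θ)) = g at e1 e2
  have r1 := congrArg Complex.re e1
  have i1 := congrArg Complex.im e1
  have r2 := congrArg Complex.re e2
  have i2 := congrArg Complex.im e2
  simp [-Complex.ofReal_cos, -Complex.ofReal_div] at r1 i1 r2 i2
  simp only [Complex.normSq_apply]
  linear_combination Real.sin θ * ((Ym θ).re * i1 - (Ym θ).im * r1 - (Yp θ).im * r2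
    + (Yp θ).re * i2)

end KNdS

namespace KNdS

variable {M : KNdS} {rm rp ω lam : ℝ} {k : ℤ} {Xp Xm Yp Ym : ℝ → ℂ} {Ψ : Pt → Fin 4 → ℂ}

/-- The angular operator is symmetric, so the separation constant is real. -/
theorem IsSeparationConstant.im_eq_zero {ε : ℂ}
    (hε : M.IsSeparationConstant rm rp ω lam k Xp Xm Yp Ym ε)
    (hb : ∃ C, ∀ θ ∈ Set.Ioo 0 Real.pi, ‖Yp θ‖ ≤ C ∧ ‖Ym θ‖ ≤ C)
    {θ₀ : ℝ} (hθ₀ : θ₀ ∈ Set.Ioo 0 Real.pi) (hY : Yp θ₀ ≠ 0 ∨ Ym θ₀ ≠ 0) : ε.im = 0 := by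
  obtain ⟨C, hC⟩ := hb
  -- Multiplication by Im ε turns the derivative into (Im ε)² times a nonnegative function, so no
  -- case distinction on the sign of Im ε is needed.
  have hder := fun θ hθ => (hε.hasDerivAt_angularFlux (θ := θ) hθ).const_mul ε.im
  have hmono : MonotoneOn (fun θ => ε.im * M.angularFlux Yp Ym θ) (Set.Ioo 0 Real.pi) := by
    refine monotoneOn_of_deriv_nonneg (convex_Ioo _ _)
      (fun θ hθ => (hder θ hθ).continuousAt.continuousWithinAt) ?_ ?_
    · intro θ hθ
      rw [interior_Ioo] at hθ
      exact (hder θ hθ).differentiableAt.differentiableWithinAt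
    · intro θ hθ
      rw [interior_Ioo] at hθ
      rw [(hder θ hθ).deriv, ← mul_assoc]
      exact mul_nonneg (mul_self_nonneg _) (mul_nonneg (Real.sin_pos_of_pos_of_lt_pi hθ.1 hθ.2).le
        (add_nonneg (Complex.normSq_nonneg _) (Complex.normSq_nonneg _)))
  have hbound : ∀ θ ∈ Set.Ioo 0 Real.pi, |ε.im * M.angularFlux Yp Ym θ|
      ≤ |ε.im| * √M.E * (2 * C ^ 2) * Real.sin θ := by
    intro θ hθ
    have hs := Real.sin_pos_of_pos_of_lt_pi hθ.1 hθ.2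
    have hE : √(M.Δθ θ) ≤ √M.E := by
      refine Real.sqrt_le_sqrt ?_
      have : 0 ≤ M.κ ^ 2 * M.a ^ 2 := by positivity
      unfold Δθ E
      nlinarith [Real.cos_sq_le_one θ]
    have h1 : |(Yp θ).im * (Ym θ).re - (Yp θ).re * (Ym θ).im| ≤ 2 * C ^ 2 := by
      have hC0 : 0 ≤ C := (norm_nonneg _).trans (hC θ hθ).1
      have b1 := (Complex.abs_im_le_norm (Yp θ)).trans (hC θ hθ).1
      have b2 := (Complex.abs_re_le_norm (Ym θ)).trans (hC θ hθ).2
      have b3 := (Complex.abs_re_le_norm (Yp θ)).trans (hC θ hθ).1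
      have b4 := (Complex.abs_im_le_norm (Ym θ)).trans (hC θ hθ).2
      calc _ ≤ |(Yp θ).im * (Ym θ).re| + |(Yp θ).re * (Ym θ).im| := abs_sub _ _
        _ ≤ C * C + C * C := by
          rw [abs_mul, abs_mul]
          gcongr
        _ = 2 * C ^ 2 := by ring
    rw [angularFlux, abs_mul, abs_mul, abs_mul, abs_of_pos hs, abs_of_nonneg (Real.sqrt_nonneg _)]
    calc _ ≤ |ε.im| * (Real.sin θ * √M.E * (2 * C ^ 2)) := by gcongr
      _ = _ := by ring
  have hzero := fun x hx => eq_zero_of_monotoneOn_of_abs_le_sin hmono hbound (x := x) hx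
  have h0 : HasDerivAt (fun θ => ε.im * M.angularFlux Yp Ym θ) 0 θ₀ := by
    refine (hasDerivAt_const θ₀ (0 : ℝ)).congr_of_eventuallyEq ?_
    filter_upwards [isOpen_Ioo.mem_nhds hθ₀] with x hx using hzero x hx
  have h1 := (hder θ₀ hθ₀).unique h0
  have hs := Real.sin_pos_of_pos_of_lt_pi hθ₀.1 hθ₀.2
  have hpos : 0 < Real.sin θ₀ * (Complex.normSq (Yp θ₀) + Complex.normSq (Ym θ₀)) := by
    refine mul_pos hs ?_
    rcases hY with hY | hY
    · exact add_pos_of_pos_of_nonneg (Complex.normSq_pos.2 hY) (Complex.normSq_nonneg _)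
    · exact add_pos_of_nonneg_of_pos (Complex.normSq_nonneg _) (Complex.normSq_pos.2 hY)
  rw [← mul_assoc] at h1
  exact mul_self_eq_zero.1 ((mul_eq_zero.1 h1).resolve_right hpos.ne')

end KNdS

/-! ### Systems `f X' = iαX + βY`, `f Y' = -iαY + β̄X` -/

/-- A one-sided Grönwall inequality. -/
theorem mul_exp_le_of_deriv_le_mul {F F' : ℝ → ℝ} {K p q : ℝ}
    (hF : ∀ r ∈ Set.Ioo p q, HasDerivAt F (F' r) r) (hK : ∀ r ∈ Set.Ioo p q, F' r ≤ K * F r)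
    {r s : ℝ} (hr : r ∈ Set.Ioo p q) (hs : s ∈ Set.Ioo p q) (hrs : r ≤ s) :
    F s * Real.exp (-K * (s - r)) ≤ F r := by
  have hd : ∀ x ∈ Set.Ioo p q, HasDerivAt (fun x => F x * Real.exp (-K * (x - r)))
      ((F' x - K * F x) * Real.exp (-K * (x - r))) x := fun x hx => by
    have h1 : HasDerivAt (fun x => -K * (x - r)) (-K) x := by
      simpa using ((hasDerivAt_id x).sub_const r).const_mul (-K)
    exact ((hF x hx).fun_mul h1.exp).congr_deriv (by ring)
  have hanti : AntitoneOn (fun x => F x * Real.exp (-K * (x - r))) (Set.Ioo p q) := by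
    refine antitoneOn_of_deriv_nonpos (convex_Ioo _ _)
      (fun x hx => (hd x hx).continuousAt.continuousWithinAt) ?_ ?_
    · intro x hx
      rw [interior_Ioo] at hx
      exact (hd x hx).differentiableAt.differentiableWithinAt
    · intro x hx
      rw [interior_Ioo] at hx
      rw [(hd x hx).deriv]
      exact mul_nonpos_of_nonpos_of_nonneg (sub_nonpos.2 (hK x hx)) (Real.exp_pos _).le
  simpa using hanti hr hs hrs

section system

variable {x y : ℝ → ℂ} {f α b₁ b₂ : ℝ → ℝ} {p q : ℝ}

/-- The terms ±iα only rotate phases. What remains is 4 Re(β conj(x) y)/f with β = b₁ + i b₂. -/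
theorem hasDerivAt_normSq_add {r : ℝ}
    (hx : HasDerivAt x ((Complex.I * α r * x r + (b₁ r + Complex.I * b₂ r) * y r) / f r) r)
    (hy : HasDerivAt y ((-Complex.I * α r * y r + (b₁ r - Complex.I * b₂ r) * x r) / f r) r) :
    HasDerivAt (fun s => Complex.normSq (x s) + Complex.normSq (y s))
      (4 * (b₁ r * ((x r).re * (y r).re + (x r).im * (y r).im)
        - b₂ r * ((x r).re * (y r).im - (x r).im * (y r).re)) / f r) r := by
  simp only [Complex.normSq_apply]
  refine (((hx.complex_re.fun_mul hx.complex_re).fun_add (hx.complex_im.fun_mul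
    hx.complex_im)).fun_add
    ((hy.complex_re.fun_mul hy.complex_re).fun_add
      (hy.complex_im.fun_mul hy.complex_im))).congr_deriv ?_
  simp [Complex.div_ofReal_re, Complex.div_ofReal_im]
  ring

theorem two_mul_abs_re_add_im_le (u v : ℂ) :
    2 * |u.re * v.re + u.im * v.im| ≤ Complex.normSq u + Complex.normSq v := by
  rw [Complex.normSq_apply, Complex.normSq_apply]
  rcases abs_cases (u.re * v.re + u.im * v.im) with ⟨h, -⟩ | ⟨h, -⟩ <;> rw [h] <;>
    nlinarith [sq_nonneg (u.re - v.re), sq_nonneg (u.im - v.im), sq_nonneg (u.re + v.re),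
      sq_nonneg (u.im + v.im)]

theorem two_mul_abs_re_sub_im_le (u v : ℂ) :
    2 * |u.re * v.im - u.im * v.re| ≤ Complex.normSq u + Complex.normSq v := by
  rw [Complex.normSq_apply, Complex.normSq_apply]
  rcases abs_cases (u.re * v.im - u.im * v.re) with ⟨h, -⟩ | ⟨h, -⟩ <;> rw [h] <;>
    nlinarith [sq_nonneg (u.re - v.im), sq_nonneg (u.im - v.re), sq_nonneg (u.re + v.im),
      sq_nonneg (u.im + v.re)]

/-- The expression in the absolute value is Im(β conj(u) v) with β = b + ic; it is at most
|β||u||v|, and 2|u||v| ≤ |u|² + |v|². -/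
theorem two_mul_abs_mixed_le (u v : ℂ) (b c : ℝ) :
    2 * |b * (u.re * v.im - u.im * v.re) + c * (u.re * v.re + u.im * v.im)|
      ≤ √(b ^ 2 + c ^ 2) * (Complex.normSq u + Complex.normSq v) := by
  have h0 : 0 ≤ b ^ 2 + c ^ 2 := by positivity
  have hN := add_nonneg (Complex.normSq_nonneg u) (Complex.normSq_nonneg v)
  rw [← abs_of_pos (zero_lt_two' ℝ), ← abs_mul]
  refine abs_le_of_sq_le_sq ?_ (mul_nonneg (Real.sqrt_nonneg _) hN)
  rw [mul_pow (√_), Real.sq_sqrt h0]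
  have h1 : (b * (u.re * v.im - u.im * v.re) + c * (u.re * v.re + u.im * v.im)) ^ 2
      ≤ (b ^ 2 + c ^ 2) * (Complex.normSq u * Complex.normSq v) := by
    rw [Complex.normSq_apply, Complex.normSq_apply]
    -- Lagrange's identity: the square supplied here is exactly the defect in the Cauchy–Schwarz
    -- inequality.
    nlinarith [sq_nonneg (b * (u.re * v.re + u.im * v.im) - c * (u.re * v.im - u.im * v.re))]
  have h2 : 4 * (Complex.normSq u * Complex.normSq v)
      ≤ (Complex.normSq u + Complex.normSq v) ^ 2 := by
    nlinarith [sq_nonneg (Complex.normSq u - Complex.normSq v)]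
  nlinarith [mul_le_mul_of_nonneg_left h2 h0]

/-- Grönwall on a compact subinterval: |x|² + |y|² grows at most exponentially to the right, so a
nonzero value at s forces nonzero values at every r ≤ s. Only this direction, towards the singular
endpoint p, is needed. -/
theorem normSq_ne_zero_of_system
    (hx : ∀ r ∈ Set.Ioo p q, HasDerivAt x
      ((Complex.I * α r * x r + (b₁ r + Complex.I * b₂ r) * y r) / f r) r)
    (hy : ∀ r ∈ Set.Ioo p q, HasDerivAt y
      ((-Complex.I * α r * y r + (b₁ r - Complex.I * b₂ r) * x r) / f r) r)
    (h₁ : ContinuousOn (fun r => b₁ r / f r) (Set.Ioo p q))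
    (h₂ : ContinuousOn (fun r => b₂ r / f r) (Set.Ioo p q))
    {r s : ℝ} (hr : r ∈ Set.Ioo p q) (hs : s ∈ Set.Ioo p q) (hrs : r ≤ s)
    (hne : x s ≠ 0 ∨ y s ≠ 0) : 0 < Complex.normSq (x r) + Complex.normSq (y r) := by
  have hsub : Set.Icc ((p + r) / 2) ((s + q) / 2) ⊆ Set.Ioo p q := fun t ht =>
    ⟨by linarith [ht.1, hr.1], by linarith [ht.2, hs.2]⟩
  obtain ⟨K₁, hK₁⟩ := isCompact_Icc.exists_bound_of_continuousOn (h₁.mono hsub)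
  obtain ⟨K₂, hK₂⟩ := isCompact_Icc.exists_bound_of_continuousOn (h₂.mono hsub)
  have hsub' : Set.Ioo ((p + r) / 2) ((s + q) / 2) ⊆ Set.Icc ((p + r) / 2) ((s + q) / 2) :=
    Set.Ioo_subset_Icc_self
  have key := mul_exp_le_of_deriv_le_mul (K := 2 * (K₁ + K₂))
    (fun t ht => hasDerivAt_normSq_add (hx t (hsub (hsub' ht))) (hy t (hsub (hsub' ht)))) ?_
    (r := r) (s := s) ⟨by linarith [hr.1], by linarith [hs.2]⟩
    ⟨by linarith [hr.1], by linarith [hs.2]⟩ hrs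
  · refine lt_of_lt_of_le (mul_pos ?_ (Real.exp_pos _)) key
    rcases hne with hne | hne
    · exact add_pos_of_pos_of_nonneg (Complex.normSq_pos.2 hne) (Complex.normSq_nonneg _)
    · exact add_pos_of_nonneg_of_pos (Complex.normSq_nonneg _) (Complex.normSq_pos.2 hne)
  · intro t ht
    have e1 := two_mul_abs_re_add_im_le (x t) (y t)
    have e2 := two_mul_abs_re_sub_im_le (x t) (y t)
    have k1 := hK₁ t (hsub' ht)
    have k2 := hK₂ t (hsub' ht)
    rw [Real.norm_eq_abs] at k1 k2
    set R := (x t).re * (y t).re + (x t).im * (y t).im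
    set P := (x t).re * (y t).im - (x t).im * (y t).re
    set N := Complex.normSq (x t) + Complex.normSq (y t)
    calc 4 * (b₁ t * R - b₂ t * P) / f t = 4 * (b₁ t / f t * R - b₂ t / f t * P) := by ring
      _ ≤ 4 * (|b₁ t / f t| * |R| + |b₂ t / f t| * |P|) := by
        rw [← abs_mul, ← abs_mul]
        linarith [le_abs_self (b₁ t / f t * R), neg_le_abs (b₂ t / f t * P)]
      _ ≤ 4 * (K₁ * (N / 2) + K₂ * (N / 2)) := by
        have a1 : |R| ≤ N / 2 := by linarith
        have a2 : |P| ≤ N / 2 := by linarith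
        have := (abs_nonneg _).trans k1
        have := (abs_nonneg _).trans k2
        gcongr
      _ = 2 * (K₁ + K₂) * N := by ring

/-- A system with a definite invariant form has solutions bounded away from zero. -/
theorem exists_lower_bound_of_gap {α' b₁' b₂' : ℝ → ℝ} {δ C : ℝ} (hpq : p < q) (hδ : 0 < δ)
    (hf : ∀ r ∈ Set.Ioo p q, f r ≠ 0)
    (hx : ∀ r ∈ Set.Ioo p q, HasDerivAt x
      ((Complex.I * α r * x r + (b₁ r + Complex.I * b₂ r) * y r) / f r) r)
    (hy : ∀ r ∈ Set.Ioo p q, HasDerivAt y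
      ((-Complex.I * α r * y r + (b₁ r - Complex.I * b₂ r) * x r) / f r) r)
    (hα : ∀ r ∈ Set.Ioo p q, HasDerivAt α (α' r) r)
    (h₁ : ∀ r ∈ Set.Ioo p q, HasDerivAt b₁ (b₁' r) r)
    (h₂ : ∀ r ∈ Set.Ioo p q, HasDerivAt b₂ (b₂' r) r)
    (hgap : ∀ r ∈ Set.Ioo p q, √(b₁ r ^ 2 + b₂ r ^ 2) + δ ≤ α r)
    (hC : ∀ r ∈ Set.Ioo p q, α r ≤ C) (hα' : ∀ r ∈ Set.Ioo p q, |α' r| ≤ C)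
    (h₁' : ∀ r ∈ Set.Ioo p q, |b₁' r| ≤ C) (h₂' : ∀ r ∈ Set.Ioo p q, |b₂' r| ≤ C)
    (hne : ∀ r ∈ Set.Ioo p q, 0 < Complex.normSq (x r) + Complex.normSq (y r)) :
    ∃ c > 0, ∃ q' > p, ∀ r ∈ Set.Ioo p q', c ≤ Complex.normSq (x r) + Complex.normSq (y r) := by
  -- The form is αN + 2 Im(β conj(x) y) with N = |x|² + |y|². The contributions ±4α Re(β conj(x)
  -- y)/f cancel, so its derivative contains only α', b₁', b₂' and stays controlled where f
  -- vanishes.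
  have hF : ∀ r ∈ Set.Ioo p q, HasDerivAt (fun s => α s * (Complex.normSq (x s)
      + Complex.normSq (y s)) + 2 * (b₁ s * ((x s).re * (y s).im - (x s).im * (y s).re)
        + b₂ s * ((x s).re * (y s).re + (x s).im * (y s).im)))
      (α' r * (Complex.normSq (x r) + Complex.normSq (y r))
        + 2 * (b₁' r * ((x r).re * (y r).im - (x r).im * (y r).re)
        + b₂' r * ((x r).re * (y r).re + (x r).im * (y r).im))) r := by
    intro r hr
    have hx' := hx r hr
    have hy' := hy r hr
    refine (((hα r hr).fun_mul (hasDerivAt_normSq_add hx' hy')).fun_add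
      ((((h₁ r hr).fun_mul ((hx'.complex_re.fun_mul hy'.complex_im).fun_sub
        (hx'.complex_im.fun_mul hy'.complex_re))).fun_add
      ((h₂ r hr).fun_mul ((hx'.complex_re.fun_mul hy'.complex_re).fun_add
        (hx'.complex_im.fun_mul hy'.complex_im)))).const_mul 2)).congr_deriv ?_
    have := hf r hr
    simp [Complex.div_ofReal_re, Complex.div_ofReal_im, Complex.normSq_apply]
    field_simp
    ring
  have hlow : ∀ r ∈ Set.Ioo p q, δ * (Complex.normSq (x r) + Complex.normSq (y r))
      ≤ α r * (Complex.normSq (x r)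
      + Complex.normSq (y r)) + 2 * (b₁ r * ((x r).re * (y r).im - (x r).im * (y r).re)
        + b₂ r * ((x r).re * (y r).re + (x r).im * (y r).im)) := by
    intro r hr
    have e := two_mul_abs_mixed_le (x r) (y r) (b₁ r) (b₂ r)
    have e' := mul_le_mul_of_nonneg_right (hgap r hr) (hne r hr).le
    linarith [neg_abs_le (b₁ r * ((x r).re * (y r).im - (x r).im * (y r).re)
        + b₂ r * ((x r).re * (y r).re + (x r).im * (y r).im))]
  have hup : ∀ r ∈ Set.Ioo p q, α r * (Complex.normSq (x r)
      + Complex.normSq (y r)) + 2 * (b₁ r * ((x r).re * (y r).im - (x r).im * (y r).re)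
        + b₂ r * ((x r).re * (y r).re + (x r).im * (y r).im))
      ≤ 2 * C * (Complex.normSq (x r) + Complex.normSq (y r)) := by
    intro r hr
    have e := two_mul_abs_mixed_le (x r) (y r) (b₁ r) (b₂ r)
    have e1 := mul_le_mul_of_nonneg_right (hgap r hr) (hne r hr).le
    have e2 := mul_le_mul_of_nonneg_right (hC r hr) (hne r hr).le
    have e3 := mul_pos hδ (hne r hr)
    linarith [le_abs_self (b₁ r * ((x r).re * (y r).im - (x r).im * (y r).re)
        + b₂ r * ((x r).re * (y r).re + (x r).im * (y r).im))]
  have hm : (p + q) / 2 ∈ Set.Ioo p q := ⟨by linarith, by linarith⟩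
  have hCpos : 0 < C := by
    linarith [hgap _ hm, hC _ hm, Real.sqrt_nonneg (b₁ ((p + q) / 2) ^ 2 + b₂ ((p + q) / 2) ^ 2)]
  -- The derivative of the form is at most CN + 2(CN/2 + CN/2) = 3CN, and N is at most the form
  -- divided by δ.
  have hK : 0 ≤ 3 * C / δ := by positivity
  refine ⟨δ * (Complex.normSq (x ((p + q) / 2)) + Complex.normSq (y ((p + q) / 2)))
    * Real.exp (-(3 * C / δ) * (q - p)) / (2 * C), ?_, (p + q) / 2, hm.1, fun r hr => ?_⟩
  · have := hne _ hm
    positivity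
  have hr' : r ∈ Set.Ioo p q := ⟨hr.1, hr.2.trans hm.2⟩
  have key := mul_exp_le_of_deriv_le_mul (K := 3 * C / δ) hF ?_ hr' hm hr.2.le
  · rw [div_le_iff₀ (by positivity), mul_comm _ (2 * C)]
    refine le_trans ?_ (key.trans (hup r hr'))
    refine mul_le_mul (hlow _ hm) (Real.exp_le_exp.2 ?_) (Real.exp_pos _).le
      ((mul_pos hδ (hne _ hm)).le.trans (hlow _ hm))
    nlinarith [hr.1, hm.2]
  · intro t ht
    have e1 := two_mul_abs_re_add_im_le (x t) (y t)
    have e2 := two_mul_abs_re_sub_im_le (x t) (y t)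
    have hN := hne t ht
    have hl := hlow t ht
    refine le_trans ?_ (mul_le_mul_of_nonneg_left hl hK)
    set R := (x t).re * (y t).re + (x t).im * (y t).im
    set P := (x t).re * (y t).im - (x t).im * (y t).re
    set N := Complex.normSq (x t) + Complex.normSq (y t)
    calc α' t * N + 2 * (b₁' t * P + b₂' t * R)
        ≤ |α' t| * N + 2 * (|b₁' t| * |P| + |b₂' t| * |R|) := by
          rw [← abs_mul, ← abs_mul]
          have := mul_le_mul_of_nonneg_right (le_abs_self (α' t)) hN.le
          linarith [le_abs_self (b₁' t * P), le_abs_self (b₂' t * R)]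
      _ ≤ C * N + 2 * (C * (N / 2) + C * (N / 2)) := by
        have a1 : |R| ≤ N / 2 := by linarith
        have a2 : |P| ≤ N / 2 := by linarith
        have a3 := hα' t ht
        have a4 := h₁' t ht
        have a5 := h₂' t ht
        gcongr
      _ = 3 * C / δ * (δ * N) := by
        field_simp
        ring

theorem ContDiffAt.eventually_hasDerivAt_and_abs_deriv_le {g : ℝ → ℝ} (hg : ContDiffAt ℝ 1 g p) :
    ∀ᶠ r in nhds p, HasDerivAt g (deriv g r) r ∧ |deriv g r| ≤ |deriv g p| + 1 := by
  have h1 : ContinuousAt (deriv g) p :=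
    ((hg.fderiv_right (m := 0) (by norm_num)).continuousAt.clm_apply continuousAt_const :
      ContinuousAt (fun r => fderiv ℝ g r 1) p)
  have h2 := (hg.eventually (by simp)).mono fun r hr => hr.differentiableAt one_ne_zero
  filter_upwards [h2, h1.abs.eventually_lt_const (lt_add_one _)] with r hr hr'
  exact ⟨hr.hasDerivAt, hr'.le⟩

theorem exists_lower_bound_of_pos (hpq : p < q) (hf : ∀ r ∈ Set.Ioo p q, f r ≠ 0)
    (hx : ∀ r ∈ Set.Ioo p q, HasDerivAt x
      ((Complex.I * α r * x r + (b₁ r + Complex.I * b₂ r) * y r) / f r) r)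
    (hy : ∀ r ∈ Set.Ioo p q, HasDerivAt y
      ((-Complex.I * α r * y r + (b₁ r - Complex.I * b₂ r) * x r) / f r) r)
    (hα : ContDiffAt ℝ 1 α p) (h₁ : ContDiffAt ℝ 1 b₁ p) (h₂ : ContDiffAt ℝ 1 b₂ p)
    (hgap : √(b₁ p ^ 2 + b₂ p ^ 2) < α p)
    (hne : ∀ r ∈ Set.Ioo p q, 0 < Complex.normSq (x r) + Complex.normSq (y r)) :
    ∃ c > 0, ∃ q' > p, ∀ r ∈ Set.Ioo p q', c ≤ Complex.normSq (x r) + Complex.normSq (y r) := by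
  obtain ⟨δ, hδ, hδ'⟩ : ∃ δ > 0, √(b₁ p ^ 2 + b₂ p ^ 2) + δ < α p :=
    ⟨(α p - √(b₁ p ^ 2 + b₂ p ^ 2)) / 2, by linarith, by linarith⟩
  have c1 : ContinuousAt (fun r => √(b₁ r ^ 2 + b₂ r ^ 2) + δ) p :=
    (((h₁.continuousAt.pow 2).add (h₂.continuousAt.pow 2)).sqrt).add_const δ
  have ev := (c1.eventually_lt hα.continuousAt hδ').and
    ((hα.continuousAt.eventually_lt_const (lt_add_one _)).and
    (hα.eventually_hasDerivAt_and_abs_deriv_le.and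
    (h₁.eventually_hasDerivAt_and_abs_deriv_le.and h₂.eventually_hasDerivAt_and_abs_deriv_le)))
  obtain ⟨ρ, hρ, hball⟩ := Metric.eventually_nhds_iff.1 ev
  have hall : ∀ r ∈ Set.Ioo p (min q (p + ρ)), r ∈ Set.Ioo p q ∧ dist r p < ρ := by
    intro r hr
    obtain ⟨h3, h4⟩ := lt_min_iff.1 hr.2
    refine ⟨⟨hr.1, h3⟩, ?_⟩
    rw [Real.dist_eq, abs_of_pos (by linarith [hr.1])]
    linarith
  exact exists_lower_bound_of_gap (lt_min hpq (by linarith)) hδ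
    (fun r hr => hf r (hall r hr).1) (fun r hr => hx r (hall r hr).1)
    (fun r hr => hy r (hall r hr).1) (fun r hr => (hball (hall r hr).2).2.2.1.1)
    (fun r hr => (hball (hall r hr).2).2.2.2.1.1) (fun r hr => (hball (hall r hr).2).2.2.2.2.1)
    (fun r hr => (hball (hall r hr).2).1.le)
    (C := max (max (α p + 1) (|deriv α p| + 1)) (max (|deriv b₁ p| + 1) (|deriv b₂ p| + 1)))
    (fun r hr => (hball (hall r hr).2).2.1.le.trans
      ((le_max_left _ _).trans (le_max_left _ _)))
    (fun r hr => (hball (hall r hr).2).2.2.1.2.trans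
      ((le_max_right _ _).trans (le_max_left _ _)))
    (fun r hr => (hball (hall r hr).2).2.2.2.1.2.trans
      ((le_max_left _ _).trans (le_max_right _ _)))
    (fun r hr => (hball (hall r hr).2).2.2.2.2.2.trans
      ((le_max_right _ _).trans (le_max_right _ _)))
    (fun r hr => hne r (hall r hr).1)

/-- If the leading coefficients satisfy `|β| < |α|` at the singular point, then solutions do not
decay there. -/
theorem exists_lower_bound (hpq : p < q) (hf : ∀ r ∈ Set.Ioo p q, f r ≠ 0)
    (hx : ∀ r ∈ Set.Ioo p q, HasDerivAt x
      ((Complex.I * α r * x r + (b₁ r + Complex.I * b₂ r) * y r) / f r) r)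
    (hy : ∀ r ∈ Set.Ioo p q, HasDerivAt y
      ((-Complex.I * α r * y r + (b₁ r - Complex.I * b₂ r) * x r) / f r) r)
    (hα : ContDiffAt ℝ 1 α p) (h₁ : ContDiffAt ℝ 1 b₁ p) (h₂ : ContDiffAt ℝ 1 b₂ p)
    (hgap : b₁ p ^ 2 + b₂ p ^ 2 < α p ^ 2)
    (hne : ∀ r ∈ Set.Ioo p q, 0 < Complex.normSq (x r) + Complex.normSq (y r)) :
    ∃ c > 0, ∃ q' > p, ∀ r ∈ Set.Ioo p q', c ≤ Complex.normSq (x r) + Complex.normSq (y r) := by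
  have hgap' : √(b₁ p ^ 2 + b₂ p ^ 2) < |α p| := by
    rw [← Real.sqrt_sq_eq_abs]
    exact Real.sqrt_lt_sqrt (by positivity) hgap
  rcases lt_abs.1 hgap' with hpos | hneg
  · exact exists_lower_bound_of_pos hpq hf hx hy hα h₁ h₂ hpos hne
  -- Exchanging x and y changes the sign of α and conjugates β, which reduces negative α to positive
  -- α.
  · obtain ⟨c, hc, q', hq', hb⟩ := exists_lower_bound_of_pos (x := y) (y := x)
      (α := fun r => -α r) (b₁ := b₁) (b₂ := fun r => -b₂ r) hpq hf
      (fun r hr => (hy r hr).congr_deriv (by push_cast; ring))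
      (fun r hr => (hx r hr).congr_deriv (by push_cast; ring)) hα.neg h₁ h₂.neg
      (by simpa using hneg) (fun r hr => by rw [add_comm]; exact hne r hr)
    exact ⟨c, hc, q', hq', fun r hr => by rw [add_comm]; exact hb r hr⟩

end system

/-! ### Infinite volume at the degenerate horizon and failure of L^p -/

theorem lintegral_Ioo_const_div_sub_eq_top {K p q : ℝ} (hK : 0 < K) (hpq : p < q) :
    ∫⁻ r in Set.Ioo p q, ENNReal.ofReal (K / (r - p)) = ⊤ := by
  by_contra hcon
  have h1 : MeasureTheory.IntegrableOn (fun r => K / (r - p)) (Set.Ioo p q) := by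
    refine ⟨(by fun_prop : Measurable fun r => K / (r - p)).aestronglyMeasurable, ?_⟩
    rw [MeasureTheory.hasFiniteIntegral_iff_ofReal]
    · exact lt_top_iff_ne_top.2 hcon
    · filter_upwards [MeasureTheory.self_mem_ae_restrict measurableSet_Ioo] with r hr
      exact div_nonneg hK.le (by linarith [hr.1])
  have h2 : MeasureTheory.IntegrableOn (fun r => (r - p)⁻¹) (Set.Ioo p q) := by
    refine (h1.const_mul K⁻¹).congr (Filter.Eventually.of_forall fun r => ?_)
    simp only
    field_simp
  have h3 : IntervalIntegrable (fun r => (r - p)⁻¹) MeasureTheory.volume p q :=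
    (intervalIntegrable_iff_integrableOn_Ioo_of_le hpq.le).2 h2
  rw [intervalIntegrable_sub_inv_iff] at h3
  rcases h3 with h3 | h3
  · exact hpq.ne h3
  · exact h3 Set.left_mem_uIcc

theorem lintegral_box_const_div_sub_eq_top {K p q a b c d : ℝ} (hK : 0 < K) (hpq : p < q)
    (hab : a < b) (hcd : c < d) :
    ∫⁻ y : ℝ × ℝ × ℝ in Set.Ioo p q ×ˢ (Set.Ioo a b ×ˢ Set.Ioo c d),
      ENNReal.ofReal (K / (y.1 - p)) = ⊤ := by
  rw [MeasureTheory.Measure.volume_eq_prod, ← MeasureTheory.Measure.prod_restrict,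
    MeasureTheory.lintegral_prod _ (by fun_prop)]
  simp only [MeasureTheory.lintegral_const]
  rw [MeasureTheory.lintegral_mul_const _ (by fun_prop), lintegral_Ioo_const_div_sub_eq_top hK hpq,
    MeasureTheory.Measure.restrict_apply_univ, MeasureTheory.Measure.volume_eq_prod,
    MeasureTheory.Measure.prod_prod, Real.volume_Ioo, Real.volume_Ioo]
  refine ENNReal.top_mul (mul_ne_zero ?_ ?_) <;> simpa using by assumption

namespace KNdS

variable {M : KNdS} {rm rp ω lam : ℝ} {k : ℤ} {Xp Xm Yp Ym : ℝ → ℂ} {Ψ : Pt → Fin 4 → ℂ}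

/-- The induced metric is diagonal. Its φφ entry is the square of the e^3 component minus that of
the e^0 component, and the second carries a factor Δ_+(r), so it is negligible near the horizon. -/
theorem det_slice_metric {t r θ φ : ℝ} (hr : 0 < r) (hΔ : 0 < M.Δr r) :
    ((metricOf M.coframe ![t, r, θ, φ]).submatrix Fin.succ Fin.succ).det
      = Real.sin θ ^ 2 * M.U r θ / (M.Δr r * M.Δθ θ * M.E ^ 2)
        * (M.Δθ θ * (r ^ 2 + M.a ^ 2) ^ 2 - M.Δr r * M.a ^ 2 * Real.sin θ ^ 2) := by
  have hU := M.U_pos hr θ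
  have hT := M.Δθ_pos θ
  have hE := M.E_pos
  have s1 := Real.sq_sqrt (div_pos hΔ hU).le
  have s2 := Real.sq_sqrt (div_pos hU hΔ).le
  have s3 := Real.sq_sqrt (div_pos hU hT).le
  have s4 := Real.sq_sqrt (div_pos hT hU).le
  rw [Matrix.det_fin_three]
  simp [metricOf, coframe, Fin.sum_univ_four, eta, Fin.succ]
  generalize √(M.Δr r / M.U r θ) = a1 at *
  generalize √(M.U r θ / M.Δr r) = a2 at *
  generalize √(M.U r θ / M.Δθ θ) = a3 at *
  generalize √(M.Δθ θ / M.U r θ) = a4 at *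
  trans (a2 ^ 2) * (a3 ^ 2) * (a4 ^ 2 * Real.sin θ ^ 2 * (r ^ 2 + M.a ^ 2) ^ 2 / M.E ^ 2
    - a1 ^ 2 * M.a ^ 2 * Real.sin θ ^ 4 / M.E ^ 2)
  · ring
  · rw [s1, s2, s3, s4]
    field_simp

/-- The four components run over all products X_± Y_±, so the sum of squares factors. All entries of
`S` have the same modulus because conjugate roots do. -/
theorem norm_sq_separated (h : M.IsExtreme rm rp) (hsep : M.IsSeparated rm rp ω k Xp Xm Yp Ym Ψ)
    {t r θ φ : ℝ} (hr : r ∈ Set.Ioo rm rp) (hθ : θ ∈ Set.Ioo 0 Real.pi) :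
    ‖(WithLp.toLp 2 (Ψ ![t, r, θ, φ]) : EuclideanSpace ℂ (Fin 4))‖ ^ 2
      = (Complex.normSq (Xp r) + Complex.normSq (Xm r))
        * (Complex.normSq (Yp θ) + Complex.normSq (Ym θ)) / (√(M.Δr r) * √(M.U r θ)) := by
  have hΔ := h.Δr_pos hr
  have hΨ := fun i => hsep.apply_eq h (x := ![t, r, θ, φ]) ⟨hr, hθ⟩ i
  have hq : ‖M.quarter r‖ ^ 2 = √(M.Δr r) := by
    rw [quarter, Complex.norm_real, Real.norm_of_nonneg (Real.rpow_nonneg hΔ.le _),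
      ← Real.rpow_natCast, ← Real.rpow_mul hΔ.le, Real.sqrt_eq_rpow]
    norm_num
  have hz : ∀ i, ‖rootFactor (M.signedRotation i) r θ‖ ^ 2 = √(M.U r θ) := by
    intro i
    rw [norm_rootFactor_sq, U]
    fin_cases i <;> simp [signedRotation]
  rw [EuclideanSpace.norm_sq_eq]
  simp only [hΨ, separatedSpinor, norm_div, norm_mul, div_pow, mul_pow, Matrix.cons_val, hz, hq,
    norm_phase, one_mul, Fin.sum_univ_four, radialFactor, angularFactor,
    Complex.normSq_eq_norm_sq]
  ring

theorem IsExtreme.Δr_le (h : M.IsExtreme rm rp) {r : ℝ} (hr : r ∈ Set.Ioo rm rp) :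
    M.Δr r ≤ M.σ₁ rm rp * (r - rm) ^ 2 := by
  rw [h.Δr_eq, mul_comm]
  refine mul_le_mul_of_nonneg_right ?_ (sq_nonneg _)
  unfold σ₁ B
  have := h.rm_pos
  -- With d = r - r_-, the left side minus the right side is -4r_- d - d².
  have h1 : (rp - r) * (r + rp + 2 * rm) ≤ (rp - rm) * (rm + rp + 2 * rm) := by
    nlinarith [mul_pos (sub_pos.2 hr.1) this, sq_nonneg (r - rm)]
  rw [mul_assoc, mul_assoc]
  gcongr

theorem IsExtreme.σ₁_pos (h : M.IsExtreme rm rp) : 0 < M.σ₁ rm rp :=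
  h.B_pos ⟨le_rfl, h.rm_lt_rp⟩

/-- The volume density of the slice blows up at the degenerate horizon. -/
theorem le_sqrt_det_slice_metric (h : M.IsExtreme rm rp) {t r θ φ s : ℝ}
    (hr : r ∈ Set.Ioo rm rp) (hs : 0 < s) (hsθ : s ≤ Real.sin θ)
    (hΔ : M.Δr r * M.a ^ 2 ≤ rm ^ 4 / 2) :
    √(s ^ 2 * rm ^ 6 / (2 * M.E ^ 2 * M.σ₁ rm rp)) / (r - rm)
      ≤ √(((metricOf M.coframe ![t, r, θ, φ]).submatrix Fin.succ Fin.succ).det) := by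
  have hr0 := h.pos hr
  have hm := h.rm_pos
  have hΔ0 := h.Δr_pos hr
  have hσ := h.σ₁_pos
  have hE := M.E_pos
  have hrs : 0 < r - rm := sub_pos.2 hr.1
  have hT : 1 ≤ M.Δθ θ := by
    unfold Δθ
    exact le_add_of_nonneg_right (by positivity)
  have hT0 := M.Δθ_pos θ
  rw [det_slice_metric hr0 hΔ0, ← Real.sqrt_sq hrs.le, ← Real.sqrt_div (by positivity)]
  apply Real.sqrt_le_sqrt
  have hU : rm ^ 2 ≤ M.U r θ := by
    unfold U
    nlinarith [hr.1, mul_nonneg (sq_nonneg M.a) (sq_nonneg (Real.cos θ))]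
  -- Since Δ_+(θ) ≥ 1, the assumption on Δ_+(r) lets the negative e^0 term remove at most half of
  -- the lower bound for the e^3 term.
  have h4 : M.Δθ θ * (rm ^ 4 / 2)
      ≤ M.Δθ θ * (r ^ 2 + M.a ^ 2) ^ 2 - M.Δr r * M.a ^ 2 * Real.sin θ ^ 2 := by
    have e1 : rm ^ 4 ≤ (r ^ 2 + M.a ^ 2) ^ 2 := by
      have : rm ^ 2 ≤ r ^ 2 + M.a ^ 2 := by nlinarith [hr.1, sq_nonneg M.a]
      calc rm ^ 4 = (rm ^ 2) ^ 2 := by ring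
        _ ≤ _ := by gcongr
    have e2 : M.Δr r * M.a ^ 2 * Real.sin θ ^ 2 ≤ rm ^ 4 / 2 := by
      have : M.Δr r * M.a ^ 2 * Real.sin θ ^ 2 ≤ M.Δr r * M.a ^ 2 * 1 := by
        gcongr
        exact Real.sin_sq_le_one θ
      linarith
    have e3 : rm ^ 4 / 2 ≤ M.Δθ θ * (rm ^ 4 / 2) := le_mul_of_one_le_left (by positivity) hT
    have e4 := mul_le_mul_of_nonneg_left e1 hT0.le
    linarith
  calc s ^ 2 * rm ^ 6 / (2 * M.E ^ 2 * M.σ₁ rm rp) / (r - rm) ^ 2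
      = s ^ 2 * rm ^ 2 * (rm ^ 4 / 2) / (M.E ^ 2 * (M.σ₁ rm rp * (r - rm) ^ 2)) := by
        field_simp
    _ ≤ Real.sin θ ^ 2 * M.U r θ * (rm ^ 4 / 2) / (M.E ^ 2 * M.Δr r) := by
        have := h.Δr_le hr
        have := M.U_pos hr0 θ
        gcongr
    _ = Real.sin θ ^ 2 * M.U r θ / (M.Δr r * M.Δθ θ * M.E ^ 2) * (M.Δθ θ * (rm ^ 4 / 2)) := by
        field_simp
    _ ≤ _ := by
        have := M.U_pos hr0 θ
        gcongr

/-- On a small box touching the horizon |Ψ| ≥ L > 0. Chebyshev's inequality for an L^p function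
makes the volume of the box finite, while its density is at least K/(r - r_-), whose integral
diverges. -/
theorem not_sliceLp_of_lower_bound (h : M.IsExtreme rm rp)
    (hsep : M.IsSeparated rm rp ω k Xp Xm Yp Ym Ψ) {θ₀ : ℝ} (hθ₀ : θ₀ ∈ Set.Ioo 0 Real.pi)
    (hYp : ContinuousAt Yp θ₀) (hYm : ContinuousAt Ym θ₀) (hY : Yp θ₀ ≠ 0 ∨ Ym θ₀ ≠ 0)
    (hX : ∃ c > 0, ∃ q > rm, ∀ r ∈ Set.Ioo rm q,
      c ≤ Complex.normSq (Xp r) + Complex.normSq (Xm r))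
    {t₀ p : ℝ} (hp : 0 < p) : ¬ M.SliceLp rm rp t₀ p Ψ := by
  intro hLp
  obtain ⟨c, hc, q, hq, hX⟩ := hX
  have hm := h.rm_pos
  -- the angular interval
  have hs₀ := Real.sin_pos_of_pos_of_lt_pi hθ₀.1 hθ₀.2
  have hd₀ : 0 < Complex.normSq (Yp θ₀) + Complex.normSq (Ym θ₀) := by
    rcases hY with hY | hY
    · exact add_pos_of_pos_of_nonneg (Complex.normSq_pos.2 hY) (Complex.normSq_nonneg _)
    · exact add_pos_of_nonneg_of_pos (Complex.normSq_nonneg _) (Complex.normSq_pos.2 hY)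
  obtain ⟨d, hd, hd'⟩ := exists_between hd₀
  obtain ⟨s, hs, hs'⟩ := exists_between hs₀
  have hcont : ContinuousAt (fun θ => Complex.normSq (Yp θ) + Complex.normSq (Ym θ)) θ₀ :=
    (Complex.continuous_normSq.continuousAt.comp hYp).add
      (Complex.continuous_normSq.continuousAt.comp hYm)
  have ev := (hcont.eventually_const_lt hd').and
    ((Real.continuous_sin.continuousAt.eventually_const_lt hs').and (isOpen_Ioo.mem_nhds hθ₀))
  obtain ⟨θ₁, θ₂, hθ, hsub⟩ := mem_nhds_iff_exists_Ioo_subset.1 ev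
  -- the radial interval
  have hΔc : ContinuousAt M.Δr rm := (M.hasDerivAt_Δr rm).continuousAt
  have hΔ0 : M.Δr rm = 0 := by rw [h.Δr_eq]; simp
  -- Δ_+(r) < 1 removes the factor √Δ_+(r) from the denominator of |Ψ|²; the next smallness
  -- condition is the one required by `le_sqrt_det_slice_metric`.
  have ev1 : ∀ᶠ r in nhds rm, M.Δr r < 1 := hΔc.eventually_lt_const (by rw [hΔ0]; norm_num)
  have ev2 : ∀ᶠ r in nhds rm, M.Δr r * M.a ^ 2 < rm ^ 4 / 2 :=
    (hΔc.mul_const (M.a ^ 2)).eventually_lt_const (by simp only [hΔ0]; rw [zero_mul]; positivity)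
  obtain ⟨l, u, hlu, hlusub⟩ := mem_nhds_iff_exists_Ioo_subset.1 (ev1.and ev2)
  set q' := min (min q rp) u with hq'
  have hrmq' : rm < q' := lt_min (lt_min hq h.rm_lt_rp) hlu.2
  have hr : ∀ r ∈ Set.Ioo rm q', r ∈ Set.Ioo rm rp ∧ r ∈ Set.Ioo rm q ∧ M.Δr r < 1 ∧
      M.Δr r * M.a ^ 2 < rm ^ 4 / 2 := by
    intro r hr
    obtain ⟨h1, h2⟩ := lt_min_iff.1 hr.2
    obtain ⟨h3, h4⟩ := lt_min_iff.1 h1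
    exact ⟨⟨hr.1, h4⟩, ⟨hr.1, h3⟩, hlusub ⟨hlu.1.trans hr.1, h2⟩⟩
  have hUle : ∀ r ∈ Set.Ioo rm rp, ∀ θ, M.U r θ ≤ rp ^ 2 + M.a ^ 2 := by
    intro r hr θ
    unfold U
    nlinarith [hr.1, hr.2, mul_le_mul_of_nonneg_left (Real.cos_sq_le_one θ) (sq_nonneg M.a)]
  have hrp : 0 < rp := hm.trans h.rm_lt_rp
  -- Here c bounds the radial factor from below, d the angular one, and r_+² + a² bounds U from
  -- above.
  set L : ℝ := √(c * d / √(rp ^ 2 + M.a ^ 2)) with hL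
  have hLpos : 0 < L := Real.sqrt_pos.2 (by positivity)
  set box : Set (ℝ × ℝ × ℝ) := Set.Ioo rm q' ×ˢ (Set.Ioo θ₁ θ₂ ×ˢ Set.Ioo 0 (2 * Real.pi)) with hbox
  have hbm : MeasurableSet box := measurableSet_Ioo.prod (measurableSet_Ioo.prod measurableSet_Ioo)
  have hnorm : ∀ y ∈ box, L
      ≤ ‖(WithLp.toLp 2 (Ψ ![t₀, y.1, y.2.1, y.2.2]) : EuclideanSpace ℂ (Fin 4))‖ := by
    rintro ⟨r, θ, φ⟩ ⟨hr1, hθ1, -⟩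
    obtain ⟨r1, r2, r3, -⟩ := hr r hr1
    obtain ⟨t1, -, t3⟩ := hsub hθ1
    refine Real.sqrt_le_iff.2 ⟨norm_nonneg _, ?_⟩
    have hΔpos := h.Δr_pos r1
    have hUpos := M.U_pos (h.pos r1) θ
    rw [norm_sq_separated h hsep r1 t3]
    have e1 : √(M.Δr r) ≤ 1 := Real.sqrt_le_one.2 r3.le
    have e2 : √(M.U r θ) ≤ √(rp ^ 2 + M.a ^ 2) := Real.sqrt_le_sqrt (hUle r r1 θ)
    have e3 : √(M.Δr r) * √(M.U r θ) ≤ √(rp ^ 2 + M.a ^ 2) := by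
      calc _ ≤ 1 * √(rp ^ 2 + M.a ^ 2) := by gcongr
        _ = _ := one_mul _
    have e4 := hX r r2
    have t1' : d < Complex.normSq (Yp θ) + Complex.normSq (Ym θ) := t1
    have n1 := hc.le.trans e4
    have n2 := hd.le.trans t1'.le
    have n3 := mul_nonneg n1 n2
    gcongr
  have hfin : M.sliceVolume rm rp t₀ box < ⊤ := by
    refine lt_of_le_of_lt (MeasureTheory.measure_mono fun y hy => ?_)
      (hLp.meas_ge_lt_top (by simpa using hp) ENNReal.ofReal_ne_top (ε := L.toNNReal)
        (by simpa using hLpos))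
    exact Real.toNNReal_le_iff_le_coe.2 (hnorm y hy)
  set K := √(s ^ 2 * rm ^ 6 / (2 * M.E ^ 2 * M.σ₁ rm rp)) with hK
  have hKpos : 0 < K := by
    have := M.E_pos
    have := h.σ₁_pos
    exact Real.sqrt_pos.2 (by positivity)
  have hboxsub : box ⊆ Set.Ioo rm rp ×ˢ (Set.Ioo 0 Real.pi ×ˢ Set.Ioo 0 (2 * Real.pi)) :=
    fun y hy => ⟨(hr _ hy.1).1, (hsub hy.2.1).2.2, hy.2.2⟩
  have htop : M.sliceVolume rm rp t₀ box = ⊤ := by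
    rw [sliceVolume, MeasureTheory.withDensity_apply _ hbm,
      MeasureTheory.Measure.restrict_restrict hbm,
      Set.inter_eq_left.2 hboxsub, eq_top_iff,
      ← lintegral_box_const_div_sub_eq_top hKpos hrmq' (hθ.1.trans hθ.2) Real.two_pi_pos]
    refine MeasureTheory.setLIntegral_mono' hbm fun y hy => ENNReal.ofReal_le_ofReal ?_
    obtain ⟨r1, -, -, r4⟩ := hr _ hy.1
    obtain ⟨-, t2, -⟩ := hsub hy.2.1
    exact le_sqrt_det_slice_metric h r1 hs (le_of_lt t2) r4.le
  exact hfin.ne htop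

end KNdS

/-! ### The radial system at the degenerate horizon -/

namespace KNdS

variable {M : KNdS} {rm rp ω lam : ℝ} {k : ℤ} {Xp Xm Yp Ym : ℝ → ℂ} {Ψ : Pt → Fin 4 → ℂ}

/-- The numerator of the potential terms in `D_{r±}`. -/
noncomputable def radialPotential (M : KNdS) (ω : ℝ) (k : ℤ) (r : ℝ) : ℝ :=
  ω * (r ^ 2 + M.a ^ 2) + M.Q * r + (k + 1 / 2) * M.E * M.a

theorem radialPotential_eq (M : KNdS) (ω : ℝ) (k : ℤ) (rm r : ℝ) :
    M.radialPotential ω k r = M.radialPotential ω k rm + (r - rm) * (ω * (r + rm) + M.Q) := by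
  unfold radialPotential
  ring

/-- When the potential numerator vanishes at r_-, σ₃ is its derivative there, the coefficient that
governs the remaining simple pole. -/
theorem σ₃_eq (hrm : rm ≠ 0) (hW : M.radialPotential ω k rm = 0) :
    M.σ₃ rm ω k = 2 * ω * rm + M.Q := by
  unfold radialPotential at hW
  unfold σ₃
  field_simp
  linear_combination -2 * hW

theorem IsSeparationConstant.hasDerivAt_Xp (h : M.IsExtreme rm rp) {ε : ℝ}
    (hε : M.IsSeparationConstant rm rp ω lam k Xp Xm Yp Ym ε) {r : ℝ} (hr : r ∈ Set.Ioo rm rp) :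
    HasDerivAt Xp (Complex.I * (M.radialPotential ω k r / M.Δr r : ℝ) * Xp r
      + (ε + Complex.I * (lam * r : ℝ)) / (√(M.Δr r) : ℝ) * Xm r) r := by
  have h0 : ((√(M.Δr r) : ℝ) : ℂ) ≠ 0 :=
    Complex.ofReal_ne_zero.2 (Real.sqrt_pos.2 (h.Δr_pos hr)).ne'
  refine (hε.diff_Xp r hr).hasDerivAt.congr_deriv ?_
  have e := hε.radial_plus r hr
  unfold Dr at e
  rw [one_mul] at e
  rw [radialPotential, ← mul_right_inj' h0]
  rw [mul_add, ← mul_assoc _ (_ / _) (Xm r), mul_div_cancel₀ _ h0]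
  push_cast at e ⊢
  linear_combination e

theorem IsSeparationConstant.hasDerivAt_Xm (h : M.IsExtreme rm rp) {ε : ℝ}
    (hε : M.IsSeparationConstant rm rp ω lam k Xp Xm Yp Ym ε) {r : ℝ} (hr : r ∈ Set.Ioo rm rp) :
    HasDerivAt Xm (-Complex.I * (M.radialPotential ω k r / M.Δr r : ℝ) * Xm r
      + (ε - Complex.I * (lam * r : ℝ)) / (√(M.Δr r) : ℝ) * Xp r) r := by
  have h0 : ((√(M.Δr r) : ℝ) : ℂ) ≠ 0 :=
    Complex.ofReal_ne_zero.2 (Real.sqrt_pos.2 (h.Δr_pos hr)).ne'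
  refine (hε.diff_Xm r hr).hasDerivAt.congr_deriv ?_
  have e := hε.radial_minus r hr
  unfold Dr at e
  rw [radialPotential, ← mul_right_inj' h0]
  rw [mul_add, ← mul_assoc _ (_ / _) (Xp r), mul_div_cancel₀ _ h0]
  push_cast at e ⊢
  linear_combination e

/-- If the potential dominates the coupling of the radial system at the degenerate horizon, then
the radial functions do not decay there. -/
theorem IsSeparationConstant.exists_radial_lower_bound (h : M.IsExtreme rm rp) {ε : ℝ}
    (hε : M.IsSeparationConstant rm rp ω lam k Xp Xm Yp Ym ε) {r₀ : ℝ}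
    (hr₀ : r₀ ∈ Set.Ioo rm rp) (hX : Xp r₀ ≠ 0 ∨ Xm r₀ ≠ 0) {f α β : ℝ → ℝ}
    (hf : ∀ r ∈ Set.Ioo rm rp, f r ≠ 0)
    (hfα : ∀ r ∈ Set.Ioo rm rp, M.radialPotential ω k r / M.Δr r = α r / f r)
    (hfβ : ∀ r ∈ Set.Ioo rm rp, 1 / √(M.Δr r) = β r / f r)
    (hα : ContDiffAt ℝ 1 α rm) (hβ : ContDiffAt ℝ 1 β rm)
    (hgap : (ε ^ 2 + lam ^ 2 * rm ^ 2) * β rm ^ 2 < α rm ^ 2) :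
    ∃ c > 0, ∃ q > rm, ∀ r ∈ Set.Ioo rm q,
      c ≤ Complex.normSq (Xp r) + Complex.normSq (Xm r) := by
  have hx : ∀ r ∈ Set.Ioo rm rp, HasDerivAt Xp ((Complex.I * α r * Xp r
      + ((ε * β r : ℝ) + Complex.I * (lam * r * β r : ℝ)) * Xm r) / f r) r := by
    intro r hr
    refine (hε.hasDerivAt_Xp h hr).congr_deriv ?_
    have e := congrArg (Complex.ofReal) (hfβ r hr)
    rw [hfα r hr]
    push_cast at e ⊢
    linear_combination (ε + Complex.I * (lam * r)) * Xm r * e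
  have hy : ∀ r ∈ Set.Ioo rm rp, HasDerivAt Xm ((-Complex.I * α r * Xm r
      + ((ε * β r : ℝ) - Complex.I * (lam * r * β r : ℝ)) * Xp r) / f r) r := by
    intro r hr
    refine (hε.hasDerivAt_Xm h hr).congr_deriv ?_
    have e := congrArg (Complex.ofReal) (hfβ r hr)
    rw [hfα r hr]
    push_cast at e ⊢
    linear_combination (ε - Complex.I * (lam * r)) * Xp r * e
  have hc : ContinuousOn (fun r => β r / f r) (Set.Ioo rm rp) := by
    refine ContinuousOn.congr (fun r hr => ContinuousAt.continuousWithinAt ?_)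
      fun r hr => (hfβ r hr).symm
    exact continuousAt_const.div (M.hasDerivAt_Δr r).continuousAt.sqrt
      (Real.sqrt_pos.2 (h.Δr_pos hr)).ne'
  -- Nonvanishing at r₀ propagates down to the horizon; the estimate is therefore run on (r_-, r₀).
  have hne : ∀ r ∈ Set.Ioo rm r₀, 0 < Complex.normSq (Xp r) + Complex.normSq (Xm r) := fun r hr =>
    normSq_ne_zero_of_system hx hy
      ((continuousOn_const.mul hc).congr fun r _ => mul_div_assoc _ _ _)
      (((continuousOn_const.mul continuousOn_id).mul hc).congr fun r _ => mul_div_assoc _ _ _)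
      ⟨hr.1, hr.2.trans hr₀.2⟩ hr₀ hr.2.le hX
  have hsub : ∀ r ∈ Set.Ioo rm r₀, r ∈ Set.Ioo rm rp := fun r hr => ⟨hr.1, hr.2.trans hr₀.2⟩
  refine exists_lower_bound hr₀.1 (fun r hr => hf r (hsub r hr)) (fun r hr => hx r (hsub r hr))
    (fun r hr => hy r (hsub r hr)) hα (contDiffAt_const.mul hβ)
    ((contDiffAt_const.mul contDiffAt_id).mul hβ) ?_ hne
  refine lt_of_eq_of_lt ?_ hgap
  ring

theorem IsExtreme.sqrt_Δr (h : M.IsExtreme rm rp) {r : ℝ} (hr : r ∈ Set.Ioo rm rp) :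
    √(M.Δr r) = (r - rm) * √(M.B rm rp r) := by
  rw [h.Δr_eq, Real.sqrt_mul (sq_nonneg _), Real.sqrt_sq (sub_pos.2 hr.1).le]

theorem IsExtreme.contDiffAt_inv_sqrt_B (h : M.IsExtreme rm rp) :
    ContDiffAt ℝ 1 (fun r => (√(M.B rm rp r))⁻¹) rm := by
  have hB := h.σ₁_pos
  refine ContDiffAt.inv (ContDiffAt.sqrt ?_ hB.ne') (Real.sqrt_pos.2 hB).ne'
  unfold B
  fun_prop

theorem IsExtreme.contDiffAt_inv_B (h : M.IsExtreme rm rp) :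
    ContDiffAt ℝ 1 (fun r => (M.B rm rp r)⁻¹) rm := by
  refine ContDiffAt.inv ?_ h.σ₁_pos.ne'
  unfold B
  fun_prop

/-- The potential has a double pole at r_-, the coupling only a simple one. After multiplication by
f = (r - r_-)² the coupling vanishes at r_-, and the gap condition is just that the potential term
does not. -/
theorem IsSeparationConstant.exists_lower_bound_of_radialPotential_ne_zero
    (h : M.IsExtreme rm rp) {ε : ℝ}
    (hε : M.IsSeparationConstant rm rp ω lam k Xp Xm Yp Ym ε) {r₀ : ℝ}
    (hr₀ : r₀ ∈ Set.Ioo rm rp) (hX : Xp r₀ ≠ 0 ∨ Xm r₀ ≠ 0)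
    (hW : M.radialPotential ω k rm ≠ 0) :
    ∃ c > 0, ∃ q > rm, ∀ r ∈ Set.Ioo rm q,
      c ≤ Complex.normSq (Xp r) + Complex.normSq (Xm r) := by
  refine hε.exists_radial_lower_bound h hr₀ hX (f := fun r => (r - rm) ^ 2)
    (α := fun r => M.radialPotential ω k r * (M.B rm rp r)⁻¹)
    (β := fun r => (r - rm) * (√(M.B rm rp r))⁻¹)
    (fun r hr => pow_ne_zero 2 (sub_pos.2 hr.1).ne') (fun r hr => ?_) (fun r hr => ?_)
    (ContDiffAt.mul ?_ h.contDiffAt_inv_B) (ContDiffAt.mul ?_ h.contDiffAt_inv_sqrt_B) ?_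
  · have h1 := (sub_pos.2 hr.1).ne'
    have h2 := (h.B_pos ⟨hr.1.le, hr.2⟩).ne'
    rw [h.Δr_eq]
    field_simp
  · have h1 := (sub_pos.2 hr.1).ne'
    have h2 := (Real.sqrt_pos.2 (h.B_pos ⟨hr.1.le, hr.2⟩)).ne'
    rw [h.sqrt_Δr hr]
    field_simp
  · unfold radialPotential
    fun_prop
  · fun_prop
  · have h1 : (M.B rm rp rm)⁻¹ ≠ 0 := inv_ne_zero h.σ₁_pos.ne'
    simp only [sub_self, zero_mul, ne_eq, OfNat.ofNat_ne_zero, not_false_eq_true, zero_pow,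
      mul_zero]
    exact sq_pos_of_ne_zero (mul_ne_zero hW h1)

/-- Potential and coupling now both have simple poles, so f = r - r_-. The gap condition reads (ε² +
λ²r_-²)/σ₁ < σ₃²/σ₁², which is the negation of (i) after multiplication by σ₁². -/
theorem IsSeparationConstant.exists_lower_bound_of_not_condI
    (h : M.IsExtreme rm rp) {ε : ℝ}
    (hε : M.IsSeparationConstant rm rp ω lam k Xp Xm Yp Ym ε) {r₀ : ℝ}
    (hr₀ : r₀ ∈ Set.Ioo rm rp) (hX : Xp r₀ ≠ 0 ∨ Xm r₀ ≠ 0)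
    (hW : M.radialPotential ω k rm = 0) (hI : ¬ M.CondI rm rp ω lam ε k) :
    ∃ c > 0, ∃ q > rm, ∀ r ∈ Set.Ioo rm q,
      c ≤ Complex.normSq (Xp r) + Complex.normSq (Xm r) := by
  refine hε.exists_radial_lower_bound h hr₀ hX (f := fun r => r - rm)
    (α := fun r => (ω * (r + rm) + M.Q) * (M.B rm rp r)⁻¹)
    (β := fun r => (√(M.B rm rp r))⁻¹)
    (fun r hr => (sub_pos.2 hr.1).ne') (fun r hr => ?_) (fun r hr => ?_)
    (ContDiffAt.mul (by fun_prop) h.contDiffAt_inv_B) h.contDiffAt_inv_sqrt_B ?_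
  · have h1 := (sub_pos.2 hr.1).ne'
    have h2 := (h.B_pos ⟨hr.1.le, hr.2⟩).ne'
    rw [h.Δr_eq, M.radialPotential_eq ω k rm, hW]
    field_simp
    ring
  · have h1 := (sub_pos.2 hr.1).ne'
    have h2 := (Real.sqrt_pos.2 (h.B_pos ⟨hr.1.le, hr.2⟩)).ne'
    rw [h.sqrt_Δr hr]
    field_simp
  · have hσ := h.σ₁_pos
    unfold CondI at hI
    rw [σ₃_eq h.rm_pos.ne' hW] at hI
    unfold σ₁ at hI hσ
    rw [inv_pow, Real.sq_sqrt hσ.le, mul_pow, ← div_eq_mul_inv, inv_pow, ← div_eq_mul_inv,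
      div_lt_div_iff₀ hσ (by positivity)]
    have hI' : (ε ^ 2 + lam ^ 2 * rm ^ 2) * M.B rm rp rm < (ω * (rm + rm) + M.Q) ^ 2 := by
      linarith [not_le.1 hI]
    nlinarith [mul_lt_mul_of_pos_right hI' hσ]

end KNdS

/-! ### The main theorem -/

theorem corollary4p2 (M : KNdS) (rm rp : ℝ) (hext : M.IsExtreme rm rp)
    (lam ω : ℝ) (k : ℤ) (Xp Xm Yp Ym : ℝ → ℂ) (Ψ : (Fin 4 → ℝ) → Fin 4 → ℂ)
    (hsol : M.IsDiracSolution rm rp lam Ψ)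
    (hsep : M.IsSeparated rm rp ω k Xp Xm Yp Ym Ψ)
    (hnontrivial : ∃ x ∈ KNdS.exterior rm rp, Ψ x ≠ 0)
    (t₀ p : ℝ) (hp : 1 ≤ p) (hLp : M.SliceLp rm rp t₀ p Ψ) :
    ∃ ε : ℝ,
      (∀ ε' : ℂ, M.IsSeparationConstant rm rp ω lam k Xp Xm Yp Ym ε' ↔ ε' = (ε : ℂ)) ∧
      (M.CondI rm rp ω lam ε k ∨ M.CondII rm rp ω k ∨ M.CondIII rm rp ω k) ∧
      (ε = 0 → M.CondI rm rp ω lam ε k ∨ M.CondIII rm rp ω k) ∧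
      (lam = 0 → M.CondI rm rp ω lam ε k ∨ M.CondII rm rp ω k) ∧
      (lam = 0 → ε = 0 → M.Q = -2 * ω * rm) := by
  obtain ⟨r₀, hr₀, θ₀, hθ₀, hX, hY⟩ := hsep.exists_ne_zero hext hnontrivial
  obtain ⟨ε', hε'⟩ := KNdS.exists_isSeparationConstant hext hsol hsep hnontrivial
  have him := hε'.im_eq_zero (KNdS.bounded_Yp_Ym hext hsol hsep hr₀ hX) hθ₀ hY
  obtain ⟨ε, rfl⟩ : ∃ ε : ℝ, (ε : ℂ) = ε' :=
    ⟨ε'.re, Complex.ext (Complex.ofReal_re _) (by simpa using him.symm)⟩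
  -- Any lower bound for the radial functions at r_- contradicts integrability; both conclusions
  -- below are obtained by producing one.
  have hnot := fun hc => KNdS.not_sliceLp_of_lower_bound hext hsep hθ₀
    (hε'.diff_Yp θ₀ hθ₀).continuousAt (hε'.diff_Ym θ₀ hθ₀).continuousAt hY hc
    (zero_lt_one.trans_le hp) hLp
  have hW : M.radialPotential ω k rm = 0 := by
    by_contra hW
    exact hnot (hε'.exists_lower_bound_of_radialPotential_ne_zero hext hr₀ hX hW)
  have hI : M.CondI rm rp ω lam ε k := by
    by_contra hI
    exact hnot (hε'.exists_lower_bound_of_not_condI hext hr₀ hX hW hI)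
  refine ⟨ε, fun ε₁ => ⟨fun hε₁ => hε₁.unique hε' hr₀ hX, ?_⟩, Or.inl hI, fun _ => Or.inl hI,
    fun _ => Or.inl hI, ?_⟩
  · rintro rfl
    exact hε'
  · rintro rfl rfl
    unfold KNdS.CondI at hI
    -- For λ = ε = 0, condition (i) says -σ₃² ≥ 0.
    have hσ : M.σ₃ rm ω k = 0 := by nlinarith [sq_nonneg (M.σ₃ rm ω k)]
    rw [KNdS.σ₃_eq hext.rm_pos.ne' hW] at hσ
    linarith
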